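/- Let $n\ge 1$, $\mu,\alpha\in\mathbb R^n$, let $\Omega$ be a real symmetric positive definite $n\times n$ matrix, and let $g=g^{(n+1)}$ be a density generator in dimension $n+1$, that is, a measurable function, non-negative on $[0,\infty)$, with $0<\int_0^\infty u^{(n+1)/2-1}g(u)\,du<\infty$. For a positive definite $d\times d$ matrix $\Sigma$, $EC_d(\mu,\Sigma,h)$ denotes the law on $\mathbb R^d$ with density $c\,|\Sigma|^{-1/2}h\big((x-\mu)'\Sigma^{-1}(x-\mu)\big)$, $c$ being the normalizing constant. Put $\omega=\mathrm{diag}(\Omega)^{1/2}$, $\bar\Omega=\omega^{-1}\Omega\omega^{-1}$, $q(x)=(x-\mu)'\Omega^{-1}(x-\mu)$, $$g^{(n)}(u)=\int_0^\infty r^{-1/2}g(r+u)\,dr,\qquad g_q(u)=g(u+q)/g^{(n)}(q),$$ $$\delta=\frac{\bar\Omega\alpha}{\sqrt{1+\alpha'\bar\Omega\alpha}},\qquad \delta_w=\omega\delta,\qquad \Delta=\mathrm{diag}\big(\sqrt{1-\delta_i^2}\big),\qquad \Psi=\Delta^{-1}(\bar\Omega-\delta\delta')\Delta^{-1}.$$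 Let $X\sim SE_n(\mu,\Omega,\alpha,g)$, i.e. $X$ has the density $2f(x)\,F_{q(x)}\big(\alpha'\omega^{-1}(x-\mu)\big)$, where $f$ is the density of $EC_n(\mu,\Omega,g^{(n)})$ and $F_q$ is the distribution function of $EC_1(0,1,g_q)$. Let $(U_0,U')'\sim EC_{1+n}\big(0,\mathrm{diag}(1,\Psi),g\big)$. Write $SN_n(\mu,\Omega,\alpha)$ for the skew-normal law, whose density is $2\varphi_n(x;\mu,\Omega)\Phi(\alpha'\omega^{-1}(x-\mu))$, with $\varphi_n(\cdot;\mu,\Omega)$ the density of $N_n(\mu,\Omega)$ and $\Phi$ the standard normal distribution function. Consider the property (P) there is a function $\phi$ with real values such that for all $t\in\mathbb R^n$ $$E\big(e^{it'X}\big)=e^{it'\mu}\,E\big(e^{i(t'\delta_w)|U_0|}\big)\,\phi\big(t'\Omega t-(t'\delta_w)^2\big).$$ 1. If $n\ge2$ and $\alpha\ne0$, then (P) holds if and only if $X$ is skew-normal, in the sense that $X\sim SN_n(\mu,c\,\Omega,\alpha)$ for some constant $c>0$. 2. The implication from $X\sim SN_n(\mu,c\,\Omega,\alpha)$ for some $c>0$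 to (P) holds for all $n\ge1$ and all $\alpha\in\mathbb R^n$. 3. (Negative answer to a conjecture of Genton and Loperfido.) If $\mu=0$, $\Omega=I_n$ and $\alpha\neq0$, then the characteristic function of $X$ is not of the form $2\phi(t't)k(t)$, $t\in\mathbb R^n$, with real functions $\phi$ and $k$ such that $k(-t)=1-k(t)$ and $0\le k(t)\le1$ for all $t$. -/

import Mathlib

open MeasureTheory ProbabilityTheory Matrix

noncomputable section

namespace SkewElliptical

/-- `g` is the density generator of a `d`-dimensional elliptical law: a (Borel) function which is
non-negative on `[0, ∞)` and for which `∫₀^∞ u^(d/2-1) g(u) du` is finite and non-zero. -/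
structure IsDensityGenerator (d : ℕ) (g : ℝ → ℝ) : Prop where
  measurable : Measurable g
  nonneg : ∀ u, 0 ≤ u → 0 ≤ g u
  integrable : IntegrableOn (fun u : ℝ => u ^ ((d : ℝ) / 2 - 1) * g u) (Set.Ioi 0)
  pos : 0 < ∫ u in Set.Ioi (0 : ℝ), u ^ ((d : ℝ) / 2 - 1) * g u

/-- The quadratic form `(x - μ)' Σ⁻¹ (x - μ)`. -/
def quadForm {ι : Type*} [Fintype ι] [DecidableEq ι]
    (μ : ι → ℝ) (S : Matrix ι ι ℝ) (x : ι → ℝ) : ℝ :=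
  (x - μ) ⬝ᵥ (S⁻¹ *ᵥ (x - μ))

/-- The density of the elliptical law `EC(μ, Σ, g)` on `ℝ^ι`:
`c |Σ|^(-1/2) g((x - μ)' Σ⁻¹ (x - μ))` with normalizing constant `c = 1 / ∫ g(x'x) dx`. -/
def ellipticalDensity {ι : Type*} [Fintype ι] [DecidableEq ι]
    (μ : ι → ℝ) (S : Matrix ι ι ℝ) (g : ℝ → ℝ) (x : ι → ℝ) : ℝ :=
  (∫ y : ι → ℝ, g (y ⬝ᵥ y))⁻¹ * (√S.det)⁻¹ * g (quadForm μ S x)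

/-- The elliptical law `EC(μ, Σ, g)` on `ℝ^ι`. -/
def ellipticalMeasure {ι : Type*} [Fintype ι] [DecidableEq ι]
    (μ : ι → ℝ) (S : Matrix ι ι ℝ) (g : ℝ → ℝ) : Measure (ι → ℝ) :=
  volume.withDensity fun x => ENNReal.ofReal (ellipticalDensity μ S g x)

/-- The cumulative distribution function of the one-dimensional law `EC₁(0, 1, g)`. -/
def ellipticalCDF (g : ℝ → ℝ) (z : ℝ) : ℝ :=
  ∫ v in Set.Iic z, ellipticalDensity (ι := Fin 1) 0 1 g (fun _ => v)

/-- The generator `g⁽ⁿ⁾(u) = ∫₀^∞ r^(-1/2) g⁽ⁿ⁺¹⁾(r + u) dr`. -/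
def marginalGenerator (g : ℝ → ℝ) (u : ℝ) : ℝ :=
  ∫ r in Set.Ioi (0 : ℝ), r ^ (-(1 / 2) : ℝ) * g (r + u)

/-- The conditional generator `g_q(u) = g⁽ⁿ⁺¹⁾(u + q) / g⁽ⁿ⁾(q)`. -/
def conditionalGenerator (g : ℝ → ℝ) (q u : ℝ) : ℝ :=
  g (u + q) / marginalGenerator g q

variable {n : ℕ}

/-- The diagonal scale matrix `ω = diag(Ω)^(1/2)`. -/
def scaleMatrix (Ω : Matrix (Fin n) (Fin n) ℝ) : Matrix (Fin n) (Fin n) ℝ :=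
  Matrix.diagonal fun i => √(Ω i i)

/-- The correlation matrix `Ω̄ = ω⁻¹ Ω ω⁻¹`. -/
def correlationMatrix (Ω : Matrix (Fin n) (Fin n) ℝ) : Matrix (Fin n) (Fin n) ℝ :=
  (scaleMatrix Ω)⁻¹ * Ω * (scaleMatrix Ω)⁻¹

/-- The vector `δ = Ω̄ α / (1 + α' Ω̄ α)^(1/2)`, i.e. the solution of
`α = Ω̄⁻¹ δ (1 - δ' Ω̄⁻¹ δ)^(-1/2)`. -/
def skewDelta (Ω : Matrix (Fin n) (Fin n) ℝ) (α : Fin n → ℝ) : Fin n → ℝ :=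
  (√(1 + α ⬝ᵥ (correlationMatrix Ω *ᵥ α)))⁻¹ • (correlationMatrix Ω *ᵥ α)

/-- The vector `δ_w = ω δ`. -/
def skewDeltaW (Ω : Matrix (Fin n) (Fin n) ℝ) (α : Fin n → ℝ) : Fin n → ℝ :=
  scaleMatrix Ω *ᵥ skewDelta Ω α

/-- The diagonal matrix `Δ = diag((1 - δ_i²)^(1/2))`. -/
def skewDiag (Ω : Matrix (Fin n) (Fin n) ℝ) (α : Fin n → ℝ) : Matrix (Fin n) (Fin n) ℝ :=
  Matrix.diagonal fun i => √(1 - skewDelta Ω α i ^ 2)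

/-- The correlation matrix `Ψ` determined by `Ω̄ = Δ Ψ Δ + δ δ'`. -/
def skewPsi (Ω : Matrix (Fin n) (Fin n) ℝ) (α : Fin n → ℝ) : Matrix (Fin n) (Fin n) ℝ :=
  (skewDiag Ω α)⁻¹ *
    (correlationMatrix Ω - Matrix.vecMulVec (skewDelta Ω α) (skewDelta Ω α)) * (skewDiag Ω α)⁻¹

/-- The density of the skew-elliptical law `SE_n(μ, Ω, α, g)`, `g = g⁽ⁿ⁺¹⁾`:
`2 f(x; μ, Ω) F(α' ω⁻¹ (x - μ))`, with `f` the density of `EC_n(μ, Ω, g⁽ⁿ⁾)` and `F` the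
distribution function of `EC₁(0, 1, g_q)`, `q = (x - μ)' Ω⁻¹ (x - μ)`. -/
def skewEllipticalDensity (μ : Fin n → ℝ) (Ω : Matrix (Fin n) (Fin n) ℝ) (α : Fin n → ℝ)
    (g : ℝ → ℝ) (x : Fin n → ℝ) : ℝ :=
  2 * ellipticalDensity μ Ω (marginalGenerator g) x *
    ellipticalCDF (conditionalGenerator g (quadForm μ Ω x))
      (α ⬝ᵥ ((scaleMatrix Ω)⁻¹ *ᵥ (x - μ)))

/-- The skew-elliptical law `SE_n(μ, Ω, α, g)`. -/
def skewEllipticalMeasure (μ : Fin n → ℝ) (Ω : Matrix (Fin n) (Fin n) ℝ) (α : Fin n → ℝ)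
    (g : ℝ → ℝ) : Measure (Fin n → ℝ) :=
  volume.withDensity fun x => ENNReal.ofReal (skewEllipticalDensity μ Ω α g x)

/-- The density `2 φ_n(x; μ, Ω) Φ(α' ω⁻¹ (x - μ))` of the skew-normal law `SN_n(μ, Ω, α)`. -/
def skewNormalDensity (μ : Fin n → ℝ) (Ω : Matrix (Fin n) (Fin n) ℝ) (α : Fin n → ℝ)
    (x : Fin n → ℝ) : ℝ :=
  2 * ((2 * Real.pi) ^ (-(n : ℝ) / 2) * (√Ω.det)⁻¹ * Real.exp (-(quadForm μ Ω x) / 2)) *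
    cdf (gaussianReal 0 1) (α ⬝ᵥ ((scaleMatrix Ω)⁻¹ *ᵥ (x - μ)))

/-- The skew-normal law `SN_n(μ, Ω, α)`. -/
def skewNormalMeasure (μ : Fin n → ℝ) (Ω : Matrix (Fin n) (Fin n) ℝ) (α : Fin n → ℝ) :
    Measure (Fin n → ℝ) :=
  volume.withDensity fun x => ENNReal.ofReal (skewNormalDensity μ Ω α x)

/-- The characteristic function `t ↦ E exp(i t'X)` of a random vector `X`. -/
def characteristicFunction {S : Type*} [MeasurableSpace S] (P : Measure S) (X : S → Fin n → ℝ)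
    (t : Fin n → ℝ) : ℂ :=
  ∫ s, Complex.exp (Complex.I * ((t ⬝ᵥ X s : ℝ) : ℂ)) ∂P

/-- The function `ψ` can be written, for some real function `φ`, in the product form
`ψ(t) = exp(i t'μ) E(exp(i (t'δ_w) |U₀|)) φ(t'Ωt - (t'δ_w)²)`. -/
def HasProductForm {S : Type*} [MeasurableSpace S] (Q : Measure S) (U₀ : S → ℝ)
    (μ : Fin n → ℝ) (Ω : Matrix (Fin n) (Fin n) ℝ) (α : Fin n → ℝ)
    (ψ : (Fin n → ℝ) → ℂ) : Prop :=
  ∃ φ : ℝ → ℝ, ∀ t : Fin n → ℝ,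
    ψ t = Complex.exp (Complex.I * ((t ⬝ᵥ μ : ℝ) : ℂ)) *
      (∫ s, Complex.exp (Complex.I * ((t ⬝ᵥ skewDeltaW Ω α * |U₀ s| : ℝ) : ℂ)) ∂Q) *
      (φ (t ⬝ᵥ (Ω *ᵥ t) - (t ⬝ᵥ skewDeltaW Ω α) ^ 2) : ℂ)

/-- The function `ψ` has the form `2 φ(t't) k(t)` with `k(-t) = 1 - k(t)` and `0 ≤ k(t) ≤ 1`. -/
def HasGentonLoperfidoForm (ψ : (Fin n → ℝ) → ℂ) : Prop :=
  ∃ (φ : ℝ → ℝ) (k : (Fin n → ℝ) → ℝ),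
    (∀ t, k (-t) = 1 - k t) ∧ (∀ t, 0 ≤ k t ∧ k t ≤ 1) ∧
      ∀ t, ψ t = ((2 * φ (t ⬝ᵥ t) * k t : ℝ) : ℂ)

end SkewElliptical

end

/-! Everything rests on a stochastic representation. Let `Z = (Z₀, Z₁)` be spherical on `ℝ^(1+n)`
with generator `g`, and let `B Bᵀ = Ω - δ_w δ_w'`. Then `X` has the law of `μ + |Z₀| δ_w + B Z₁`
(`map_skewMap_spherical`). Hence the characteristic function of `X` is `exp(i t'μ) h(t'δ_w, Bᵀt)`
with `h(a, b) = E exp(i (a |Z₀| + b'Z₁))`, and (P) says that `h(a, b) = h(a, 0) φ(b'b)` along these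
arguments.

The modulus on `Z₀` disappears in the real part: `Re h(a, b) = χ(a² + b'b)`, where `χ` is the
characteristic generator of `Z` (`re_absChar`). Real parts of (P) therefore give `χ(x + y) = χ(x)
φ(y)`. For `n ≥ 2` and `α ≠ 0` the reachable pairs `(x, y)` fill a sector `x ≥ 0`, `y ≥ κ x`
(`exists_vector_of_le`). Setting `x = 0` gives `φ = χ`, and continuity forces `χ(s) = exp(-c s / 2)`
(`exists_exp_of_mul_of_le`). Absolute continuity excludes `c = 0`, so `Z` is normal and `X`
skew-normal.

Conversely, the law of `X` determines `χ`, again through real parts. If `X` is skew-normal then `Z`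
is normal, its coordinates are independent and `h` factors (`absChar_normal`).

A characteristic function of the Genton–Loperfido form is real, so `X` would be symmetric about `0`.
The term `|Z₀| δ_w` pushes `X` to one side and makes this impossible
(`not_forall_im_vecChar_eq_zero`). -/

noncomputable section

namespace SkewElliptical

/-! ### Characteristic functions and linear images of elliptical laws. -/

section

variable {ι : Type*} [Fintype ι]

/-- The characteristic function `w ↦ ∫ exp(i w'x) dν(x)` of a measure on `ℝ^ι`. -/
def vecChar (ν : Measure (ι → ℝ)) (w : ι → ℝ) : ℂ :=
  ∫ x, Complex.exp (Complex.I * ((w ⬝ᵥ x : ℝ) : ℂ)) ∂ν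

@[fun_prop]
theorem continuous_dotProduct_right (w : ι → ℝ) : Continuous fun x : ι → ℝ => w ⬝ᵥ x :=
  continuous_const.dotProduct continuous_id

theorem measure_ext_of_vecChar {ν ν' : Measure (ι → ℝ)} [IsFiniteMeasure ν] [IsFiniteMeasure ν']
    (h : ∀ w, vecChar ν w = vecChar ν' w) : ν = ν' := by
  classical
  refine Measure.ext_of_charFunDual (funext fun L => ?_)
  have hL : ∀ x : ι → ℝ, L x = (fun i => L (Pi.single i 1)) ⬝ᵥ x := by
    intro x
    have hx : L x = ∑ i, L (Pi.single i (x i)) := by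
      rw [← map_sum, Finset.univ_sum_single]
    rw [hx]
    refine Finset.sum_congr rfl fun i _ => ?_
    have : (Pi.single i (x i) : ι → ℝ) = x i • Pi.single i 1 := by
      rw [← Pi.single_smul, smul_eq_mul, mul_one]
    rw [this, map_smul, smul_eq_mul, mul_comm]
  have key : ∀ m : Measure (ι → ℝ), charFunDual m L = vecChar m fun i => L (Pi.single i 1) :=
    fun m => integral_congr_ae (.of_forall fun x => by
      change Complex.exp (L x * Complex.I) = _
      rw [hL x, mul_comm])
  rw [key, key, h]

theorem lintegral_comp_mulVec [DecidableEq ι] {A : Matrix ι ι ℝ} (hA : A.det ≠ 0)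
    {f : (ι → ℝ) → ENNReal} (hf : Measurable f) :
    ∫⁻ u, f (A *ᵥ u) = ENNReal.ofReal |A.det|⁻¹ * ∫⁻ x, f x := by
  have h := Real.map_matrix_volume_pi_eq_smul_volume_pi hA
  have hm : Measurable (Matrix.toLin' A) :=
    (LinearMap.continuous_of_finiteDimensional _).measurable
  have h2 := lintegral_map (μ := volume) hf hm
  rw [h, lintegral_smul_measure] at h2
  simpa [abs_inv] using h2.symm

theorem quadForm_zero_one [DecidableEq ι] (x : ι → ℝ) : quadForm 0 1 x = x ⬝ᵥ x := by
  simp [quadForm]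

theorem quadForm_mulVec [DecidableEq ι] {A : Matrix ι ι ℝ} (hA : A.det ≠ 0) (u : ι → ℝ) :
    quadForm 0 (A * Aᵀ) (A *ᵥ u) = u ⬝ᵥ u := by
  have hu : IsUnit A.det := hA.isUnit
  have hu' : IsUnit Aᵀ.det := by rwa [det_transpose]
  rw [quadForm, sub_zero, Matrix.mul_inv_rev, mulVec_mulVec, Matrix.mul_assoc,
    nonsing_inv_mul _ hu, Matrix.mul_one, dotProduct_mulVec, vecMul_mulVec, mul_nonsing_inv _ hu',
    vecMul_one]

@[fun_prop]
theorem continuous_quadForm [DecidableEq ι] (μ : ι → ℝ) (S : Matrix ι ι ℝ) :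
    Continuous (quadForm μ S) := by
  unfold quadForm
  have h : Continuous fun x : ι → ℝ => x - μ := by fun_prop
  exact h.dotProduct (continuous_const.matrix_mulVec h)

theorem measurable_ellipticalDensity [DecidableEq ι] {g : ℝ → ℝ} (hg : Measurable g)
    (μ : ι → ℝ) (S : Matrix ι ι ℝ) : Measurable (ellipticalDensity μ S g) := by
  unfold ellipticalDensity
  exact (hg.comp (continuous_quadForm μ S).measurable).const_mul _

theorem map_mulVec_ellipticalMeasure [DecidableEq ι] {g : ℝ → ℝ} (hg : Measurable g)
    {A : Matrix ι ι ℝ} (hA : A.det ≠ 0) :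
    (ellipticalMeasure 0 1 g).map (A *ᵥ ·) = ellipticalMeasure 0 (A * Aᵀ) g := by
  have hm : Measurable fun u : ι → ℝ => A *ᵥ u :=
    (continuous_const.matrix_mulVec continuous_id).measurable
  ext s hs
  rw [Measure.map_apply hm hs, ellipticalMeasure, ellipticalMeasure,
    withDensity_apply _ (hm hs), withDensity_apply _ hs, ← lintegral_indicator (hm hs),
    ← lintegral_indicator hs]
  have hmeas : Measurable (s.indicator fun x => ENNReal.ofReal
      (ellipticalDensity 0 (A * Aᵀ) g x)) :=
    (measurable_ellipticalDensity hg 0 (A * Aᵀ)).ennreal_ofReal.indicator hs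
  have h := lintegral_comp_mulVec hA hmeas
  have hd : 0 < |A.det| := abs_pos.2 hA
  have h3 : ∫⁻ x, (s.indicator fun x => ENNReal.ofReal (ellipticalDensity 0 (A * Aᵀ) g x)) x =
      ENNReal.ofReal |A.det| * ∫⁻ u, (s.indicator fun x => ENNReal.ofReal
        (ellipticalDensity 0 (A * Aᵀ) g x)) (A *ᵥ u) := by
    rw [h, ← mul_assoc, ← ENNReal.ofReal_mul hd.le, mul_inv_cancel₀ hd.ne', ENNReal.ofReal_one,
      one_mul]
  rw [h3, ← lintegral_const_mul _ (by exact hmeas.comp hm)]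
  refine lintegral_congr fun u => ?_
  by_cases hu : A *ᵥ u ∈ s
  · rw [Set.indicator_of_mem hu, Set.indicator_of_mem (show u ∈ _ from hu),
      ← ENNReal.ofReal_mul hd.le]
    congr 1
    rw [ellipticalDensity, ellipticalDensity, quadForm_mulVec hA, quadForm_zero_one, det_mul,
      det_transpose, Real.sqrt_mul_self_eq_abs, det_one, Real.sqrt_one]
    field_simp
  · rw [Set.indicator_of_notMem hu, Set.indicator_of_notMem (show u ∉ _ from hu), mul_zero]

end

/-! ### Integration over `ℝ^(1+n)` and the change of variables behind the representation. -/

section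

variable {n : ℕ}

/-- Substituting `r = v²` cancels `r^(-1/2)` against the Jacobian `2v`; the remaining factor `2`
unfolds the half-line to all of `ℝ`. In this form the generator is visibly a marginal of `g`. -/
theorem marginalGenerator_eq_integral_sq (g : ℝ → ℝ) (u : ℝ) :
    marginalGenerator g u = ∫ v : ℝ, g (u + v ^ 2) := by
  have h1 := integral_comp_rpow_Ioi_of_pos (g := fun r : ℝ => r ^ (-(1 / 2) : ℝ) * g (r + u))
    (p := 2) (by norm_num)
  have h2 := integral_comp_abs (f := fun v : ℝ => g (u + v ^ 2))
  simp only [sq_abs] at h2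
  rw [marginalGenerator, ← h1, h2, ← integral_const_mul]
  refine setIntegral_congr_fun measurableSet_Ioi fun x hx => ?_
  have hx : 0 < x := hx
  have h3 : (x ^ 2) ^ (-(1 / 2) : ℝ) = x⁻¹ := by
    rw [← Real.rpow_two, ← Real.rpow_mul hx.le, ← Real.rpow_neg_one]; norm_num
  have h4 : x ^ ((2 : ℝ) - 1) = x := by norm_num
  simp only [h3, h4, Real.rpow_two, smul_eq_mul]
  rw [add_comm u]
  field_simp

/-- The identification of `ℝ × ℝ^n` with `ℝ^(1+n)`. -/
def sumPiEquiv (n : ℕ) : ℝ × (Fin n → ℝ) ≃ᵐ (Unit ⊕ Fin n → ℝ) :=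
  ((MeasurableEquiv.funUnique Unit ℝ).symm.prodCongr (MeasurableEquiv.refl _)).trans
    (MeasurableEquiv.sumPiEquivProdPi fun _ : Unit ⊕ Fin n => ℝ).symm

theorem sumPiEquiv_apply (p : ℝ × (Fin n → ℝ)) :
    sumPiEquiv n p = Sum.elim (fun _ => p.1) p.2 := by
  ext i
  rcases i with i | i <;> rfl

theorem measurePreserving_sumPiEquiv : MeasurePreserving (sumPiEquiv n) := by
  refine MeasurePreserving.trans (μb := volume) ?_ ?_
  · exact (volume_preserving_funUnique Unit ℝ).symm.prod (MeasurePreserving.id _)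
  · exact volume_measurePreserving_sumPiEquivProdPi_symm _

theorem lintegral_sum_pi {f : (Unit ⊕ Fin n → ℝ) → ENNReal} (hf : Measurable f) :
    ∫⁻ z, f z = ∫⁻ v : ℝ, ∫⁻ u : Fin n → ℝ, f (Sum.elim (fun _ => v) u) := by
  rw [← (measurePreserving_sumPiEquiv (n := n)).lintegral_comp hf, Measure.volume_eq_prod,
    lintegral_prod _ (by exact (hf.comp (sumPiEquiv n).measurable).aemeasurable)]
  simp only [sumPiEquiv_apply]

theorem integral_sum_pi {E : Type*} [NormedAddCommGroup E] [NormedSpace ℝ E]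
    (f : (Unit ⊕ Fin n → ℝ) → E) :
    ∫ z, f z = ∫ p : ℝ × (Fin n → ℝ), f (Sum.elim (fun _ => p.1) p.2) := by
  rw [← (measurePreserving_sumPiEquiv (n := n)).integral_comp (sumPiEquiv n).measurableEmbedding]
  simp only [sumPiEquiv_apply]

theorem integrable_sum_pi {E : Type*} [NormedAddCommGroup E]
    {f : (Unit ⊕ Fin n → ℝ) → E} (hf : Integrable f) :
    Integrable fun p : ℝ × (Fin n → ℝ) => f (Sum.elim (fun _ => p.1) p.2) := by
  have := ((measurePreserving_sumPiEquiv (n := n)).integrable_comp_emb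
    (sumPiEquiv n).measurableEmbedding).2 hf
  simpa only [Function.comp_def, sumPiEquiv_apply] using this

theorem sumElim_dotProduct_self (v : ℝ) (u : Fin n → ℝ) :
    (Sum.elim (fun _ => v) u : Unit ⊕ Fin n → ℝ) ⬝ᵥ Sum.elim (fun _ => v) u = v ^ 2 + u ⬝ᵥ u := by
  simp [dotProduct, sq]

theorem lintegral_comp_abs_eq (h : ℝ → ENNReal) :
    ∫⁻ u : ℝ, h |u| = 2 * ∫⁻ u in Set.Ioi 0, h u := by
  have h1 : ∫⁻ u in Set.Ioi (0 : ℝ), h |u| = ∫⁻ u in Set.Ioi 0, h u :=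
    setLIntegral_congr_fun measurableSet_Ioi fun u hu => by rw [abs_of_pos (Set.mem_Ioi.1 hu)]
  have h2 : ∫⁻ u in Set.Iio (0 : ℝ), h |u| = ∫⁻ u in Set.Ioi 0, h u := by
    rw [← h1, ← lintegral_indicator measurableSet_Iio, ← lintegral_indicator measurableSet_Ioi,
      ← lintegral_neg_eq_self]
    refine lintegral_congr fun u => ?_
    simp [Set.indicator]
  rw [← lintegral_add_compl _ (measurableSet_Ioi (a := (0 : ℝ))), h1, Set.compl_Ioi,
    ← setLIntegral_congr Iio_ae_eq_Iic, h2, two_mul]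

theorem lintegral_Ioi_comp_affine {h : ℝ → ENNReal} (hh : Measurable h) {s : ℝ} (hs : 0 < s)
    (p : ℝ) :
    ∫⁻ u in Set.Ioi 0, h (p - s * u) = ENNReal.ofReal s⁻¹ * ∫⁻ v in Set.Iic p, h v := by
  -- With the open half-line, `p - s * u < p` matches `0 < u` exactly.
  rw [← setLIntegral_congr Iio_ae_eq_Iic, ← lintegral_indicator measurableSet_Iio,
    ← lintegral_indicator measurableSet_Ioi]
  set k : ℝ → ENNReal := (Set.Iio p).indicator h
  have hk : Measurable k := hh.indicator measurableSet_Iio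
  have h1 : ∫⁻ v, k v = ∫⁻ v, k (p - v) := (lintegral_sub_left_eq_self k p).symm
  have hk' : Measurable fun v => k (p - v) := hk.comp (measurable_const.sub measurable_id)
  have h2 := lintegral_map (μ := volume) hk' (measurable_const_mul s)
  rw [Real.map_volume_mul_left hs.ne', lintegral_smul_measure, abs_of_pos (inv_pos.2 hs)] at h2
  rw [h1, ← smul_eq_mul, h2]
  refine lintegral_congr fun u => ?_
  simp [k, Set.indicator, hs]

/-- The normalizing constant of `EC(0, 1, g)` on `ℝ^(1+n)`. -/
def sphericalMass (n : ℕ) (g : ℝ → ℝ) : ℝ := ∫ z : Unit ⊕ Fin n → ℝ, g (z ⬝ᵥ z)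

theorem lintegral_spherical {g : ℝ → ℝ} (hg : Measurable g) {f : (Unit ⊕ Fin n → ℝ) → ENNReal}
    (hf : Measurable f) (hC : 0 ≤ sphericalMass n g) :
    ∫⁻ z, f z ∂(ellipticalMeasure 0 1 g) = ENNReal.ofReal (sphericalMass n g)⁻¹ *
      ∫⁻ v : ℝ, ∫⁻ u : Fin n → ℝ,
        f (Sum.elim (fun _ => v) u) * ENNReal.ofReal (g (v ^ 2 + u ⬝ᵥ u)) := by
  have hd : Continuous fun z : Unit ⊕ Fin n → ℝ => z ⬝ᵥ z := continuous_id.dotProduct continuous_id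
  have hm : Measurable fun z : Unit ⊕ Fin n → ℝ => f z * ENNReal.ofReal (g (z ⬝ᵥ z)) :=
    hf.mul (hg.comp hd.measurable).ennreal_ofReal
  rw [ellipticalMeasure, lintegral_withDensity_eq_lintegral_mul _
    (measurable_ellipticalDensity hg _ _).ennreal_ofReal hf]
  simp_rw [← sumElim_dotProduct_self]
  rw [← lintegral_sum_pi hm, ← lintegral_const_mul _ hm]
  refine lintegral_congr fun z => ?_
  rw [Pi.mul_apply, ellipticalDensity, quadForm_zero_one, det_one, Real.sqrt_one, inv_one, mul_one]
  change ENNReal.ofReal ((sphericalMass n g)⁻¹ * _) * _ = _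
  rw [ENNReal.ofReal_mul (inv_nonneg.2 hC)]
  ring

/-- For fixed `z₀`, an affine change of variables in `z₁` turns the integral into one over the value
`x` of the map. Hypothesis `hq` completes the square in `u = |z₀|`. After exchanging the integrals,
folding `z₀` onto `u > 0` gives the factor `2`, and `v = η'(x - μ) - s u` produces the
distribution-function integral. -/
theorem lintegral_skew_representation {g : ℝ → ℝ} (hg : Measurable g)
    (hC : 0 ≤ sphericalMass n g) {μ η d : Fin n → ℝ} {Ω B : Matrix (Fin n) (Fin n) ℝ} {s : ℝ}
    (hs : 0 < s) (hB : B.det ≠ 0)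
    (hq : ∀ (u : ℝ) (x : Fin n → ℝ), u ^ 2 + quadForm (μ + u • d) (B * Bᵀ) x =
      quadForm μ Ω x + (η ⬝ᵥ (x - μ) - s * u) ^ 2)
    {F : (Fin n → ℝ) → ENNReal} (hF : Measurable F) :
    ∫⁻ z, F (μ + |z (Sum.inl ())| • d + B *ᵥ fun i => z (Sum.inr i)) ∂(ellipticalMeasure 0 1 g) =
      ∫⁻ x, ENNReal.ofReal (2 * (sphericalMass n g)⁻¹ * |B.det|⁻¹ * s⁻¹) *
        (∫⁻ v in Set.Iic (η ⬝ᵥ (x - μ)), ENNReal.ofReal (g (quadForm μ Ω x + v ^ 2))) * F x := by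
  have hT : Continuous fun z : Unit ⊕ Fin n → ℝ =>
      μ + |z (Sum.inl ())| • d + B *ᵥ fun i => z (Sum.inr i) := by
    have : Continuous fun z : Unit ⊕ Fin n → ℝ => B *ᵥ fun i => z (Sum.inr i) :=
      continuous_const.matrix_mulVec (by fun_prop)
    fun_prop
  have hG : Measurable fun u => ENNReal.ofReal (g u) := hg.ennreal_ofReal
  have hη : Continuous fun x : Fin n → ℝ => η ⬝ᵥ (x - μ) :=
    continuous_const.dotProduct (by fun_prop)
  have step (v : ℝ) : ∫⁻ u : Fin n → ℝ, F (μ + |v| • d + B *ᵥ u) *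
        ENNReal.ofReal (g (v ^ 2 + u ⬝ᵥ u)) = ENNReal.ofReal |B.det|⁻¹ *
      ∫⁻ x, F x * ENNReal.ofReal (g (quadForm μ Ω x + (η ⬝ᵥ (x - μ) - s * |v|) ^ 2)) := by
    have h1 := lintegral_comp_mulVec hB (f := fun y => F (μ + |v| • d + y) *
      ENNReal.ofReal (g (v ^ 2 + quadForm 0 (B * Bᵀ) y))) (by
        refine (hF.comp (by fun_prop)).mul (hG.comp (by fun_prop)))
    simp only [quadForm_mulVec hB] at h1
    rw [h1, ← lintegral_add_left_eq_self _ (-(μ + |v| • d))]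
    congr 1
    refine lintegral_congr fun x => ?_
    rw [← hq |v| x, sq_abs, add_neg_cancel_left]
    have hx : -(μ + |v| • d) + x - 0 = x - (μ + |v| • d) := by abel
    rw [quadForm, quadForm, hx]
  rw [lintegral_spherical hg (by exact hF.comp hT.measurable) hC]
  simp only [Sum.elim_inl, Sum.elim_inr]
  simp_rw [step]
  have hm : Measurable (Function.uncurry fun (v : ℝ) (x : Fin n → ℝ) => F x *
      ENNReal.ofReal (g (quadForm μ Ω x + (η ⬝ᵥ (x - μ) - s * |v|) ^ 2))) := by
    refine (hF.comp measurable_snd).mul (hG.comp (Continuous.measurable ?_))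
    have h1 := (continuous_quadForm μ Ω).comp (continuous_snd (X := ℝ))
    have h2 := hη.comp (continuous_snd (X := ℝ))
    exact h1.add ((h2.sub (by fun_prop)).pow 2)
  rw [lintegral_const_mul _ hm.lintegral_prod_right, lintegral_lintegral_swap hm.aemeasurable,
    ← mul_assoc, ← lintegral_const_mul _ hm.lintegral_prod_left]
  refine lintegral_congr fun x => ?_
  have hx : Measurable fun w : ℝ => ENNReal.ofReal (g (quadForm μ Ω x + w ^ 2)) :=
    hG.comp (by fun_prop)
  have hx' : Measurable fun u : ℝ => ENNReal.ofReal
      (g (quadForm μ Ω x + (η ⬝ᵥ (x - μ) - s * u) ^ 2)) := hG.comp (by fun_prop)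
  rw [lintegral_const_mul _ (by exact hx'.comp measurable_abs), lintegral_comp_abs_eq fun u => ENNReal.ofReal
      (g (quadForm μ Ω x + (η ⬝ᵥ (x - μ) - s * u) ^ 2)),
    lintegral_Ioi_comp_affine hx hs]
  have hs' : 0 ≤ s⁻¹ := by positivity
  have hC' : 0 ≤ (sphericalMass n g)⁻¹ := by positivity
  rw [ENNReal.ofReal_mul (by positivity), ENNReal.ofReal_mul (by positivity),
    ENNReal.ofReal_mul (by positivity), ENNReal.ofReal_ofNat]
  ring

end

/-! ### Linear algebra of `Ω - δ_w δ_w'`. -/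

section

variable {n : ℕ}

/-- The vector `η = ω⁻¹ α`. -/
def skewEta (Ω : Matrix (Fin n) (Fin n) ℝ) (α : Fin n → ℝ) : Fin n → ℝ :=
  (scaleMatrix Ω)⁻¹ *ᵥ α

/-- The scalar `(1 + η'Ωη)^(1/2)`, `η = ω⁻¹ α`. -/
def skewNorm (Ω : Matrix (Fin n) (Fin n) ℝ) (α : Fin n → ℝ) : ℝ :=
  √(1 + skewEta Ω α ⬝ᵥ (Ω *ᵥ skewEta Ω α))

/-- The matrix `Ω - δ_w δ_w'`. -/
def skewCov (Ω : Matrix (Fin n) (Fin n) ℝ) (α : Fin n → ℝ) : Matrix (Fin n) (Fin n) ℝ :=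
  Ω - vecMulVec (skewDeltaW Ω α) (skewDeltaW Ω α)

theorem exists_mul_transpose_eq {m : Type*} [Fintype m] [DecidableEq m] {S : Matrix m m ℝ}
    (hS : S.PosDef) : ∃ A : Matrix m m ℝ, A.det ≠ 0 ∧ A * Aᵀ = S := by
  obtain ⟨C, hC⟩ : ∃ C : Matrix m m ℝ, S = Cᴴ * C := by
    open scoped MatrixOrder in
    exact (CStarAlgebra.nonneg_iff_eq_star_mul_self.1 hS.posSemidef.nonneg)
  refine ⟨Cᵀ, fun h => ?_, ?_⟩
  · have := hS.det_pos
    rw [hC, det_mul, conjTranspose_eq_transpose_of_trivial, h, zero_mul] at this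
    exact lt_irrefl _ this
  · rw [transpose_transpose, hC, conjTranspose_eq_transpose_of_trivial]

section
variable {Ω : Matrix (Fin n) (Fin n) ℝ} (hΩ : Ω.PosDef) (α : Fin n → ℝ)
include hΩ

theorem scale_ne_zero (i : Fin n) : √(Ω i i) ≠ 0 :=
  (Real.sqrt_pos.2 (hΩ.diag_pos)).ne'

theorem scaleMatrix_inv :
    (scaleMatrix Ω)⁻¹ = Matrix.diagonal fun i => (√(Ω i i))⁻¹ := by
  refine Matrix.inv_eq_left_inv ?_
  rw [scaleMatrix, diagonal_mul_diagonal, ← diagonal_one]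
  congr 1; funext i
  exact inv_mul_cancel₀ (scale_ne_zero hΩ i)

theorem scaleMatrix_mul_inv : scaleMatrix Ω * (scaleMatrix Ω)⁻¹ = 1 := by
  rw [scaleMatrix_inv hΩ, scaleMatrix, diagonal_mul_diagonal, ← diagonal_one]
  congr 1; funext i
  exact mul_inv_cancel₀ (scale_ne_zero hΩ i)

theorem scaleMatrix_inv_mul : (scaleMatrix Ω)⁻¹ * scaleMatrix Ω = 1 :=
  mul_eq_one_comm.1 (scaleMatrix_mul_inv hΩ)

theorem dotProduct_scaleMatrix_inv (x : Fin n → ℝ) :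
    α ⬝ᵥ ((scaleMatrix Ω)⁻¹ *ᵥ x) = skewEta Ω α ⬝ᵥ x := by
  rw [skewEta, scaleMatrix_inv hΩ]
  simp only [dotProduct, mulVec_diagonal]
  exact Finset.sum_congr rfl fun i _ => by ring

theorem eta_quad_nonneg : 0 ≤ skewEta Ω α ⬝ᵥ (Ω *ᵥ skewEta Ω α) := by
  simpa using hΩ.posSemidef.dotProduct_mulVec_nonneg (skewEta Ω α)

theorem skewNorm_pos : 0 < skewNorm Ω α :=
  Real.sqrt_pos.2 (by linarith [eta_quad_nonneg hΩ α])

theorem skewNorm_sq : skewNorm Ω α ^ 2 = 1 + skewEta Ω α ⬝ᵥ (Ω *ᵥ skewEta Ω α) :=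
  Real.sq_sqrt (by linarith [eta_quad_nonneg hΩ α])

theorem skewDeltaW_eq : skewDeltaW Ω α = (skewNorm Ω α)⁻¹ • (Ω *ᵥ skewEta Ω α) := by
  have h1 : correlationMatrix Ω *ᵥ α = (scaleMatrix Ω)⁻¹ *ᵥ (Ω *ᵥ skewEta Ω α) := by
    rw [correlationMatrix, skewEta, mulVec_mulVec, mulVec_mulVec, Matrix.mul_assoc]
  rw [skewDeltaW, skewDelta, h1, dotProduct_scaleMatrix_inv hΩ, ← skewNorm, mulVec_smul,
    mulVec_mulVec, scaleMatrix_mul_inv hΩ, one_mulVec]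

theorem eta_dotProduct_deltaW :
    skewEta Ω α ⬝ᵥ skewDeltaW Ω α = (skewNorm Ω α ^ 2 - 1) / skewNorm Ω α := by
  rw [skewDeltaW_eq hΩ, dotProduct_smul, skewNorm_sq hΩ, smul_eq_mul]
  ring

theorem inv_mulVec_deltaW : Ω⁻¹ *ᵥ skewDeltaW Ω α = (skewNorm Ω α)⁻¹ • skewEta Ω α := by
  rw [skewDeltaW_eq hΩ, mulVec_smul, mulVec_mulVec, nonsing_inv_mul _ hΩ.det_pos.ne'.isUnit,
    one_mulVec]

theorem transpose_eq : Ωᵀ = Ω := by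
  simpa using hΩ.isHermitian.eq

/-- Sherman–Morrison: since `δ_w = Ωη / s` with `s² = 1 + η'Ωη`, a rank-one downdate of `Ω` along
`δ_w` is inverse to a rank-one update of `Ω⁻¹` along `η`. Positive definiteness is then read off
from the inverse. -/
theorem skewCov_mul :
    skewCov Ω α * (Ω⁻¹ + vecMulVec (skewEta Ω α) (skewEta Ω α)) = 1 := by
  have hs := (skewNorm_pos hΩ α).ne'
  have h1 : skewDeltaW Ω α ᵥ* Ω⁻¹ = (skewNorm Ω α)⁻¹ • skewEta Ω α := by
    rw [← inv_mulVec_deltaW hΩ α, ← vecMul_transpose, transpose_nonsing_inv, transpose_eq hΩ]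
  have h2 : Ω *ᵥ skewEta Ω α = skewNorm Ω α • skewDeltaW Ω α := by
    rw [skewDeltaW_eq hΩ, smul_smul, mul_inv_cancel₀ hs, one_smul]
  rw [skewCov, Matrix.sub_mul, Matrix.mul_add, Matrix.mul_add,
    mul_nonsing_inv _ hΩ.det_pos.ne'.isUnit, mul_vecMulVec, vecMulVec_mul, h1, h2,
    vecMulVec_mul_vecMulVec, dotProduct_comm, eta_dotProduct_deltaW hΩ]
  ext i j
  simp only [Matrix.sub_apply, Matrix.add_apply, vecMulVec_apply, Pi.smul_apply, smul_eq_mul]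
  field_simp
  ring

theorem skewCov_inv : (skewCov Ω α)⁻¹ = Ω⁻¹ + vecMulVec (skewEta Ω α) (skewEta Ω α) :=
  Matrix.inv_eq_right_inv (skewCov_mul hΩ α)

theorem skewCov_posDef : (skewCov Ω α).PosDef := by
  have h : skewCov Ω α = (Ω⁻¹ + vecMulVec (skewEta Ω α) (skewEta Ω α))⁻¹ :=
    (Matrix.inv_eq_left_inv (skewCov_mul hΩ α)).symm
  rw [h]
  refine Matrix.PosDef.inv (hΩ.inv.add_posSemidef ?_)
  simpa using posSemidef_vecMulVec_self_star (skewEta Ω α)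

/-- The matrix determinant lemma, with `1 - δ_w'Ω⁻¹δ_w = s⁻²`. -/
theorem skewCov_det : (skewCov Ω α).det = Ω.det / skewNorm Ω α ^ 2 := by
  have hs := (skewNorm_pos hΩ α).ne'
  have h : skewCov Ω α = Ω + replicateCol Unit (-skewDeltaW Ω α) *
      replicateRow Unit (skewDeltaW Ω α) := by
    ext i j
    simp [skewCov, Matrix.mul_apply, vecMulVec_apply, sub_eq_add_neg]
  rw [h, det_add_replicateCol_mul_replicateRow hΩ.det_pos.ne'.isUnit]
  have h2 : (replicateRow Unit (skewDeltaW Ω α) * Ω⁻¹ *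
      replicateCol Unit (-skewDeltaW Ω α)).det =
      -(skewDeltaW Ω α ⬝ᵥ (Ω⁻¹ *ᵥ skewDeltaW Ω α)) := by
    rw [det_unique, Matrix.mul_assoc, ← replicateCol_mulVec,
      replicateRow_mul_replicateCol_apply, mulVec_neg, dotProduct_neg]
  have h3 : ∀ Y : Matrix Unit Unit ℝ, (1 + Y).det = 1 + Y.det := by
    intro Y
    rw [det_unique, det_unique, Matrix.add_apply, Matrix.one_apply_eq]
  rw [h3, h2, inv_mulVec_deltaW hΩ, dotProduct_smul, dotProduct_comm, eta_dotProduct_deltaW hΩ,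
    smul_eq_mul]
  field_simp
  ring

theorem skewCov_mulVec_eta : skewCov Ω α *ᵥ skewEta Ω α =
    (skewNorm Ω α)⁻¹ • skewDeltaW Ω α := by
  have hs := (skewNorm_pos hΩ α).ne'
  have h2 : Ω *ᵥ skewEta Ω α = skewNorm Ω α • skewDeltaW Ω α := by
    rw [skewDeltaW_eq hΩ, smul_smul, mul_inv_cancel₀ hs, one_smul]
  rw [skewCov, sub_mulVec, h2, vecMulVec_mulVec, dotProduct_comm, eta_dotProduct_deltaW hΩ]
  ext i
  simp
  field_simp
  ring

/-- Completing the square in `u`: by the formula for the inverse, the coefficient of `u²` on the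
left is `1 + δ_w'Ω⁻¹δ_w + (η'δ_w)² = s²` and that of `u` is `-2 s η'(x - μ)`. -/
theorem quadForm_skewCov (μ : Fin n → ℝ) (u : ℝ) (x : Fin n → ℝ) :
    u ^ 2 + quadForm (μ + u • skewDeltaW Ω α) (skewCov Ω α) x =
      quadForm μ Ω x + (skewEta Ω α ⬝ᵥ (x - μ) - skewNorm Ω α * u) ^ 2 := by
  have hs := (skewNorm_pos hΩ α).ne'
  have hx : x - (μ + u • skewDeltaW Ω α) = (x - μ) - u • skewDeltaW Ω α := by abel
  rw [quadForm, quadForm, hx, skewCov_inv hΩ]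
  set y := x - μ
  have h1 : skewDeltaW Ω α ⬝ᵥ (Ω⁻¹ *ᵥ y) = (skewNorm Ω α)⁻¹ * (skewEta Ω α ⬝ᵥ y) := by
    rw [dotProduct_mulVec, ← transpose_eq hΩ.inv, vecMul_transpose, inv_mulVec_deltaW hΩ,
      smul_dotProduct, smul_eq_mul]
  have h2 := eta_dotProduct_deltaW hΩ α
  rw [add_mulVec, vecMulVec_mulVec]
  simp only [mulVec_sub, mulVec_smul, dotProduct_add, sub_dotProduct, dotProduct_sub,
    smul_dotProduct, dotProduct_smul, smul_eq_mul, inv_mulVec_deltaW hΩ, h1, h2,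
    dotProduct_comm _ (skewEta Ω α), op_smul_eq_smul]
  field_simp
  ring

/-- The `i`-th diagonal entry of the positive definite `Ω - δ_w δ_w'` is `Ω i i * (1 - δ_i²)`. Thus
`Δ` is invertible. -/
theorem skewDelta_sq_lt (i : Fin n) : 0 < 1 - skewDelta Ω α i ^ 2 := by
  have h := (skewCov_posDef hΩ α).diag_pos (i := i)
  have h3 : skewDeltaW Ω α i = √(Ω i i) * skewDelta Ω α i := by
    rw [skewDeltaW, scaleMatrix, mulVec_diagonal]
  have h4 : 0 < Ω i i := hΩ.diag_pos
  rw [skewCov, Matrix.sub_apply, vecMulVec_apply, h3] at h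
  have h5 := Real.mul_self_sqrt h4.le
  have : 0 < Ω i i * (1 - skewDelta Ω α i ^ 2) := by
    calc _ < _ := h
      _ = Ω i i - √(Ω i i) * √(Ω i i) * skewDelta Ω α i ^ 2 := by ring
      _ = _ := by rw [h5]; ring
  exact (mul_pos_iff_of_pos_left h4).1 this

theorem skewDiag_mul_inv : skewDiag Ω α * (skewDiag Ω α)⁻¹ = 1 := by
  refine mul_nonsing_inv _ ?_
  rw [skewDiag, det_diagonal]
  exact (Finset.prod_ne_zero_iff.2 fun i _ =>
    (Real.sqrt_pos.2 (skewDelta_sq_lt hΩ α i)).ne').isUnit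

theorem skewDiag_inv_mul : (skewDiag Ω α)⁻¹ * skewDiag Ω α = 1 :=
  mul_eq_one_comm.1 (skewDiag_mul_inv hΩ α)

theorem skewCov_eq : scaleMatrix Ω * skewDiag Ω α * skewPsi Ω α *
    (scaleMatrix Ω * skewDiag Ω α)ᵀ = skewCov Ω α := by
  have h1 : (scaleMatrix Ω * skewDiag Ω α)ᵀ = skewDiag Ω α * scaleMatrix Ω := by
    rw [transpose_mul, scaleMatrix, skewDiag, diagonal_transpose, diagonal_transpose]
  have h2 : vecMulVec (skewDeltaW Ω α) (skewDeltaW Ω α) =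
      scaleMatrix Ω * vecMulVec (skewDelta Ω α) (skewDelta Ω α) * scaleMatrix Ω := by
    rw [mul_vecMulVec, vecMulVec_mul, skewDeltaW, ← vecMul_transpose]
    congr 1
    rw [scaleMatrix, diagonal_transpose]
  rw [h1, skewCov, h2, skewPsi]
  calc _ = scaleMatrix Ω * (skewDiag Ω α * (skewDiag Ω α)⁻¹) * (correlationMatrix Ω -
        vecMulVec (skewDelta Ω α) (skewDelta Ω α)) * ((skewDiag Ω α)⁻¹ * skewDiag Ω α) *
        scaleMatrix Ω := by simp only [Matrix.mul_assoc]
    _ = scaleMatrix Ω * (scaleMatrix Ω)⁻¹ * Ω * ((scaleMatrix Ω)⁻¹ * scaleMatrix Ω) - 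
        scaleMatrix Ω * vecMulVec (skewDelta Ω α) (skewDelta Ω α) * scaleMatrix Ω := by
      rw [skewDiag_mul_inv hΩ, skewDiag_inv_mul hΩ, Matrix.mul_one, Matrix.mul_one,
        Matrix.mul_sub, Matrix.sub_mul, correlationMatrix]
      simp only [Matrix.mul_assoc]
    _ = _ := by rw [scaleMatrix_mul_inv hΩ, scaleMatrix_inv_mul hΩ, Matrix.one_mul, Matrix.mul_one]

theorem skewPsi_posDef : (skewPsi Ω α).PosDef := by
  have hd : IsUnit (scaleMatrix Ω * skewDiag Ω α) := by
    rw [isUnit_iff_exists_inv]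
    exact ⟨(skewDiag Ω α)⁻¹ * (scaleMatrix Ω)⁻¹, by
      rw [Matrix.mul_assoc, ← Matrix.mul_assoc (skewDiag Ω α), skewDiag_mul_inv hΩ, Matrix.one_mul,
        scaleMatrix_mul_inv hΩ]⟩
  have h := skewCov_posDef hΩ α
  rw [← skewCov_eq hΩ] at h
  exact (Matrix.IsUnit.posDef_star_right_conjugate_iff hd).1 h

end

end

/-! ### The skew-elliptical density and the stochastic representation. -/

section

variable {n : ℕ}

/-- Dividing by `g⁽ⁿ⁾(q)` already normalizes `g_q`, so the constant in `EC₁(0, 1, g_q)` is `1`. -/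
theorem ellipticalCDF_conditionalGenerator {g : ℝ → ℝ} {q : ℝ} (hq : marginalGenerator g q ≠ 0)
    (z : ℝ) :
    ellipticalCDF (conditionalGenerator g q) z =
      (marginalGenerator g q)⁻¹ * ∫ v in Set.Iic z, g (q + v ^ 2) := by
  have h1 : ∫ y : Fin 1 → ℝ, conditionalGenerator g q (y ⬝ᵥ y) = 1 := by
    have h := (volume_preserving_funUnique (Fin 1) ℝ).integral_comp
      (MeasurableEquiv.funUnique (Fin 1) ℝ).measurableEmbedding
      (fun v : ℝ => conditionalGenerator g q (v ^ 2))
    have h2 : ∀ y : Fin 1 → ℝ, conditionalGenerator g q (y ⬝ᵥ y) =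
        conditionalGenerator g q (MeasurableEquiv.funUnique (Fin 1) ℝ y ^ 2) := by
      intro y
      simp [dotProduct, sq]
    have h3 : ∫ y : Fin 1 → ℝ, conditionalGenerator g q (y ⬝ᵥ y) =
        ∫ v : ℝ, conditionalGenerator g q (v ^ 2) := by
      simp_rw [h2]
      convert h
    rw [h3]
    simp_rw [conditionalGenerator, add_comm _ q]
    rw [integral_div, ← marginalGenerator_eq_integral_sq, div_self hq]
  have h2 : ∀ v : ℝ, ellipticalDensity (ι := Fin 1) 0 1 (conditionalGenerator g q) (fun _ => v) =
      (marginalGenerator g q)⁻¹ * g (q + v ^ 2) := by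
    intro v
    rw [ellipticalDensity, h1, quadForm_zero_one, det_one, Real.sqrt_one, inv_one, mul_one,
      one_mul, conditionalGenerator, div_eq_inv_mul, add_comm q]
    simp [dotProduct, sq]
  rw [ellipticalCDF]
  simp_rw [h2]
  rw [integral_const_mul]

theorem integrable_of_sphericalMass_ne_zero {g : ℝ → ℝ} (hC : sphericalMass n g ≠ 0) :
    Integrable fun z : Unit ⊕ Fin n → ℝ => g (z ⬝ᵥ z) := by
  by_contra h
  exact hC (integral_undef h)

theorem integral_marginalGenerator {g : ℝ → ℝ} (hC : sphericalMass n g ≠ 0) :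
    ∫ y : Fin n → ℝ, marginalGenerator g (y ⬝ᵥ y) = sphericalMass n g := by
  have h := integrable_sum_pi (integrable_of_sphericalMass_ne_zero hC)
  rw [sphericalMass, integral_sum_pi]
  rw [Measure.volume_eq_prod] at h ⊢
  rw [integral_prod_symm _ h]
  simp only [marginalGenerator_eq_integral_sq, sumElim_dotProduct_self, add_comm (_ ^ 2)]

theorem sphericalMass_nonneg {g : ℝ → ℝ} (hg : ∀ u, 0 ≤ u → 0 ≤ g u) : 0 ≤ sphericalMass n g :=
  integral_nonneg fun z => hg _ (by simpa using dotProduct_star_self_nonneg z)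

/-- Tonelli, transported by an affine map. Sections of `g` may fail to be integrable on a null set
of `x`; off that set Bochner and Lebesgue integrals can be interchanged. -/
theorem ae_integrable_section {g : ℝ → ℝ} (hg : Measurable g) (hC : sphericalMass n g ≠ 0)
    (μ : Fin n → ℝ) {Ω : Matrix (Fin n) (Fin n) ℝ} (hΩ : Ω.PosDef) :
    ∀ᵐ x : Fin n → ℝ, Integrable fun v : ℝ => g (quadForm μ Ω x + v ^ 2) := by
  obtain ⟨A, hA, rfl⟩ := exists_mul_transpose_eq hΩ
  have h := integrable_sum_pi (integrable_of_sphericalMass_ne_zero hC)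
  have hJ : Measurable fun q : ℝ => ∫⁻ v : ℝ, ‖g (q + v ^ 2)‖ₑ := by
    refine Measurable.lintegral_prod_right' (f := fun p : ℝ × ℝ => ‖g (p.1 + p.2 ^ 2)‖ₑ) ?_
    exact (hg.comp (by fun_prop)).enorm
  have h1 : ∫⁻ y : Fin n → ℝ, ∫⁻ v : ℝ, ‖g (y ⬝ᵥ y + v ^ 2)‖ₑ < ⊤ := by
    have h2 := h.hasFiniteIntegral
    rw [Measure.volume_eq_prod] at h h2
    rw [HasFiniteIntegral, lintegral_prod_symm _ h.aestronglyMeasurable.enorm] at h2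
    simpa only [sumElim_dotProduct_self, add_comm (_ ^ 2)] using h2
  have h3 := lintegral_comp_mulVec hA (f := fun y => ∫⁻ v : ℝ, ‖g (quadForm 0 (A * Aᵀ) y + v ^ 2)‖ₑ)
    (hJ.comp (continuous_quadForm _ _).measurable)
  simp only [quadForm_mulVec hA] at h3
  rw [h3, ← lintegral_add_right_eq_self _ (-μ)] at h1
  have h4 : ∫⁻ x : Fin n → ℝ, ∫⁻ v : ℝ, ‖g (quadForm μ (A * Aᵀ) x + v ^ 2)‖ₑ < ⊤ := by
    have hx : ∀ x : Fin n → ℝ, quadForm 0 (A * Aᵀ) (x + -μ) = quadForm μ (A * Aᵀ) x := by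
      intro x; rw [quadForm, sub_zero, ← sub_eq_add_neg, quadForm]
    simp only [hx] at h1
    refine (ENNReal.mul_lt_top_iff.1 h1).elim (fun h => h.2) (fun h => ?_)
    rcases h with h | h
    · simp [hA] at h
    · rw [h]; exact ENNReal.zero_lt_top
  filter_upwards [ae_lt_top (hJ.comp (continuous_quadForm _ _).measurable) h4.ne] with x hx
  exact ⟨(hg.comp (by fun_prop)).aestronglyMeasurable, hx⟩

theorem quadForm_nonneg (μ : Fin n → ℝ) {Ω : Matrix (Fin n) (Fin n) ℝ} (hΩ : Ω.PosDef)
    (x : Fin n → ℝ) : 0 ≤ quadForm μ Ω x := by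
  simpa [quadForm] using hΩ.inv.posSemidef.dotProduct_mulVec_nonneg (x - μ)

theorem skewEllipticalDensity_eq {g : ℝ → ℝ} (hg0 : ∀ u, 0 ≤ u → 0 ≤ g u)
    (hC : sphericalMass n g ≠ 0) {μ : Fin n → ℝ} {Ω : Matrix (Fin n) (Fin n) ℝ} (hΩ : Ω.PosDef)
    (α : Fin n → ℝ) {x : Fin n → ℝ}
    (hx : Integrable fun v : ℝ => g (quadForm μ Ω x + v ^ 2)) :
    skewEllipticalDensity μ Ω α g x = 2 * (sphericalMass n g)⁻¹ * (√Ω.det)⁻¹ *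
      ∫ v in Set.Iic (skewEta Ω α ⬝ᵥ (x - μ)), g (quadForm μ Ω x + v ^ 2) := by
  have hnn : ∀ v : ℝ, 0 ≤ g (quadForm μ Ω x + v ^ 2) := fun v =>
    hg0 _ (add_nonneg (quadForm_nonneg μ hΩ x) (sq_nonneg v))
  rw [skewEllipticalDensity, ellipticalDensity, integral_marginalGenerator hC,
    dotProduct_scaleMatrix_inv hΩ]
  -- Where `g⁽ⁿ⁾` vanishes the conditional generator is a division by zero, but the density is `0`
  -- and the nonnegative section has zero integral, so both sides agree.
  by_cases hq : marginalGenerator g (quadForm μ Ω x) = 0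
  · have h0 : ∫ v in Set.Iic (skewEta Ω α ⬝ᵥ (x - μ)), g (quadForm μ Ω x + v ^ 2) = 0 := by
      refine le_antisymm ?_ (integral_nonneg hnn)
      rw [← hq, marginalGenerator_eq_integral_sq]
      exact setIntegral_le_integral hx (.of_forall hnn)
    rw [hq, h0]; simp
  · rw [ellipticalCDF_conditionalGenerator hq]
    field_simp

/-- The representation `X = μ + |Z₀| δ_w + B Z₁` in law. It is tested on indicators; the constants
agree because `|det B| s = √(det Ω)`. -/
theorem map_skewMap_spherical {g : ℝ → ℝ} (hg : Measurable g) (hg0 : ∀ u, 0 ≤ u → 0 ≤ g u)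
    (hC : sphericalMass n g ≠ 0) (μ : Fin n → ℝ) {Ω : Matrix (Fin n) (Fin n) ℝ} (hΩ : Ω.PosDef)
    (α : Fin n → ℝ) {B : Matrix (Fin n) (Fin n) ℝ} (hB : B * Bᵀ = skewCov Ω α) :
    (ellipticalMeasure 0 1 g).map (fun z : Unit ⊕ Fin n → ℝ =>
      μ + |z (Sum.inl ())| • skewDeltaW Ω α + B *ᵥ fun i => z (Sum.inr i)) =
      skewEllipticalMeasure μ Ω α g := by
  have hs := skewNorm_pos hΩ α
  have hdet : B.det * B.det = Ω.det / skewNorm Ω α ^ 2 := by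
    rw [← skewCov_det hΩ, ← hB, det_mul, det_transpose]
  have hdet0 : B.det ≠ 0 := by
    intro h
    have := div_pos hΩ.det_pos (pow_pos hs 2)
    rw [← hdet, h, zero_mul] at this
    exact lt_irrefl _ this
  have habs : |B.det|⁻¹ * (skewNorm Ω α)⁻¹ = (√Ω.det)⁻¹ := by
    have : |B.det| * skewNorm Ω α = √Ω.det := by
      rw [← Real.sqrt_mul_self_eq_abs, hdet, Real.sqrt_div' _ (by positivity),
        Real.sqrt_sq hs.le, div_mul_cancel₀ _ hs.ne']
    rw [← this, mul_inv]
  have hT : Measurable fun z : Unit ⊕ Fin n → ℝ =>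
      μ + |z (Sum.inl ())| • skewDeltaW Ω α + B *ᵥ fun i => z (Sum.inr i) := by
    have : Continuous fun z : Unit ⊕ Fin n → ℝ => B *ᵥ fun i => z (Sum.inr i) :=
      continuous_const.matrix_mulVec (by fun_prop)
    exact Continuous.measurable (by fun_prop)
  ext E hE
  have hind : Measurable (E.indicator (1 : (Fin n → ℝ) → ENNReal)) := measurable_one.indicator hE
  have h := lintegral_skew_representation hg (sphericalMass_nonneg hg0) (μ := μ) hs hdet0
    (fun u x => by rw [hB]; exact quadForm_skewCov hΩ α μ u x) hind
  rw [← lintegral_map hind hT, lintegral_indicator_one hE] at h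
  rw [h, skewEllipticalMeasure, withDensity_apply _ hE, ← lintegral_indicator hE]
  refine lintegral_congr_ae ?_
  filter_upwards [ae_integrable_section hg hC μ hΩ] with x hx
  by_cases hxE : x ∈ E
  · have hnn : ∀ v : ℝ, 0 ≤ g (quadForm μ Ω x + v ^ 2) := fun v =>
      hg0 _ (add_nonneg (quadForm_nonneg μ hΩ x) (sq_nonneg v))
    rw [Set.indicator_of_mem hxE, Set.indicator_of_mem hxE, Pi.one_apply, mul_one,
      skewEllipticalDensity_eq hg0 hC hΩ α hx, mul_assoc (2 * _), habs,
      ← ofReal_integral_eq_lintegral_ofReal hx.integrableOn (.of_forall hnn),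
      ← ENNReal.ofReal_mul (by
        have := sphericalMass_nonneg (n := n) hg0
        positivity)]
  · rw [Set.indicator_of_notMem hxE, Set.indicator_of_notMem hxE, mul_zero]

end

/-! ### The characteristic generator of a spherical law and the real part of `absChar`. -/

section

/-- The Householder reflection in the hyperplane orthogonal to `w - w'` exchanges two vectors of
equal length. -/
theorem exists_orthogonal_mulVec_eq {ι : Type*} [Fintype ι] [DecidableEq ι] {w w' : ι → ℝ}
    (h : w ⬝ᵥ w = w' ⬝ᵥ w') :
    ∃ O : Matrix ι ι ℝ, O * Oᵀ = 1 ∧ Oᵀ *ᵥ w = w' := by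
  by_cases hv : (w - w') ⬝ᵥ (w - w') = 0
  · have : w - w' = 0 := dotProduct_self_eq_zero.1 hv
    exact ⟨1, by simp, by simp [sub_eq_zero.1 this]⟩
  · set v := w - w' with hvdef
    have ht : (1 - (2 / (v ⬝ᵥ v)) • vecMulVec v v)ᵀ = 1 - (2 / (v ⬝ᵥ v)) • vecMulVec v v := by
      rw [transpose_sub, transpose_one, transpose_smul, transpose_vecMulVec]
    refine ⟨1 - (2 / (v ⬝ᵥ v)) • vecMulVec v v, ?_, ?_⟩
    · rw [ht, Matrix.sub_mul, Matrix.mul_sub, Matrix.mul_sub, Matrix.one_mul, Matrix.mul_one,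
        Matrix.one_mul, smul_mul_smul_comm, vecMulVec_mul_vecMulVec]
      ext i j
      simp only [Matrix.sub_apply, Matrix.smul_apply, vecMulVec_apply, Pi.smul_apply, smul_eq_mul]
      field_simp
      ring
    · have h2 : v ⬝ᵥ w = (v ⬝ᵥ v) / 2 := by
        simp only [hvdef, sub_dotProduct, dotProduct_sub]
        rw [← h, dotProduct_comm w' w]
        ring
      rw [ht, sub_mulVec, one_mulVec, smul_mulVec, vecMulVec_mulVec, h2]
      ext i
      simp only [Pi.sub_apply, Pi.smul_apply, op_smul_eq_smul, smul_eq_mul]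
      field_simp
      simp [hvdef]

section bounded
variable {T : Type*} [MeasurableSpace T] {m : Measure T} [IsFiniteMeasure m] {f : T → ℝ}

theorem integrable_cexp (hf : AEMeasurable f m) :
    Integrable (fun x => Complex.exp (Complex.I * (f x : ℂ))) m := by
  refine Integrable.of_bound (C := 1) ?_ (.of_forall fun x => ?_)
  · exact (Complex.measurable_exp.comp_aemeasurable
      ((Complex.measurable_ofReal.comp_aemeasurable hf).const_mul _)).aestronglyMeasurable
  · rw [mul_comm, Complex.norm_exp_ofReal_mul_I]

theorem re_integral_cexp (hf : AEMeasurable f m) :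
    (∫ x, Complex.exp (Complex.I * (f x : ℂ)) ∂m).re = ∫ x, Real.cos (f x) ∂m := by
  rw [← RCLike.re_eq_complex_re, ← integral_re (integrable_cexp hf)]
  simp [mul_comm Complex.I, Complex.exp_ofReal_mul_I_re]

theorem integrable_cos (hf : AEMeasurable f m) : Integrable (fun x => Real.cos (f x)) m :=
  Integrable.of_bound (C := 1) (Real.measurable_cos.comp_aemeasurable hf).aestronglyMeasurable
    (.of_forall fun _ => Real.abs_cos_le_one _)

end bounded

variable {n : ℕ} {g : ℝ → ℝ}

/-- The spherical law `EC(0, 1, g)` on `ℝ^(1+n)`. -/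
abbrev sphericalMeasure (n : ℕ) (g : ℝ → ℝ) : Measure (Unit ⊕ Fin n → ℝ) :=
  ellipticalMeasure 0 1 g

theorem sphericalMeasure_map_orthogonal (hg : Measurable g)
    {O : Matrix (Unit ⊕ Fin n) (Unit ⊕ Fin n) ℝ} (hO : O * Oᵀ = 1) :
    (sphericalMeasure n g).map (O *ᵥ ·) = sphericalMeasure n g := by
  have hd : O.det ≠ 0 := by
    intro h
    have := congrArg Matrix.det hO
    rw [det_mul, h, zero_mul, det_one] at this
    exact zero_ne_one this
  rw [map_mulVec_ellipticalMeasure hg hd, hO]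

theorem vecChar_spherical_congr (hg : Measurable g) {w w' : Unit ⊕ Fin n → ℝ}
    (h : w ⬝ᵥ w = w' ⬝ᵥ w') :
    vecChar (sphericalMeasure n g) w = vecChar (sphericalMeasure n g) w' := by
  obtain ⟨O, hO, hw⟩ := exists_orthogonal_mulVec_eq h
  have hm : Continuous fun u : Unit ⊕ Fin n → ℝ => O *ᵥ u :=
    continuous_const.matrix_mulVec continuous_id
  rw [← sphericalMeasure_map_orthogonal hg hO, vecChar, integral_map hm.aemeasurable
    (Continuous.aestronglyMeasurable (by fun_prop)), sphericalMeasure_map_orthogonal hg hO, ← hw,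
    vecChar]
  simp only [dotProduct_mulVec, mulVec_transpose]

/-- The characteristic generator of the spherical law: its characteristic function at `w` is
`sphericalChar n g (w'w)`. -/
def sphericalChar (n : ℕ) (g : ℝ → ℝ) (s : ℝ) : ℝ :=
  (vecChar (sphericalMeasure n g) (Sum.elim (fun _ => √s) 0)).re

theorem vecChar_neg {ι : Type*} [Fintype ι] (m : Measure (ι → ℝ)) (w : ι → ℝ) :
    vecChar m (-w) = (starRingEnd ℂ) (vecChar m w) := by
  rw [vecChar, vecChar, ← integral_conj]
  refine integral_congr_ae (.of_forall fun x => ?_)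
  simp [← Complex.exp_conj]

/-- The value depends only on the length of `w`; it is real because `w` and `-w` have the same
length. -/
theorem vecChar_spherical (hg : Measurable g) (w : Unit ⊕ Fin n → ℝ) :
    vecChar (sphericalMeasure n g) w = sphericalChar n g (w ⬝ᵥ w) := by
  have h0 : 0 ≤ w ⬝ᵥ w := by simpa using dotProduct_star_self_nonneg w
  have h1 : vecChar (sphericalMeasure n g) w =
      vecChar (sphericalMeasure n g) (Sum.elim (fun _ => √(w ⬝ᵥ w)) 0) :=
    vecChar_spherical_congr hg (by rw [sumElim_dotProduct_self, Real.sq_sqrt h0]; simp)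
  have h2 : (starRingEnd ℂ) (vecChar (sphericalMeasure n g) w) = vecChar (sphericalMeasure n g) w := by
    rw [← vecChar_neg]
    exact vecChar_spherical_congr hg (by simp)
  rw [sphericalChar, ← h1]
  exact (Complex.conj_eq_iff_re.1 h2).symm

theorem integral_spherical {E : Type*} [NormedAddCommGroup E] [NormedSpace ℝ E]
    (hg : Measurable g) (hg0 : ∀ u, 0 ≤ u → 0 ≤ g u) (f : (Unit ⊕ Fin n → ℝ) → E) :
    ∫ z, f z ∂(sphericalMeasure n g) = ∫ z, ((sphericalMass n g)⁻¹ * g (z ⬝ᵥ z)) • f z := by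
  rw [sphericalMeasure, ellipticalMeasure, integral_withDensity_eq_integral_toReal_smul
    (measurable_ellipticalDensity hg _ _).ennreal_ofReal (.of_forall fun _ => ENNReal.ofReal_lt_top)]
  refine integral_congr_ae (.of_forall fun z => ?_)
  have h0 : 0 ≤ z ⬝ᵥ z := by simpa using dotProduct_star_self_nonneg z
  have h1 : ellipticalDensity 0 1 g z = (sphericalMass n g)⁻¹ * g (z ⬝ᵥ z) := by
    rw [ellipticalDensity, quadForm_zero_one, det_one, Real.sqrt_one, inv_one, mul_one,
      sphericalMass]
  simp only
  rw [h1, ENNReal.toReal_ofReal (mul_nonneg (inv_nonneg.2 (sphericalMass_nonneg hg0)) (hg0 _ h0))]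

theorem isProbabilityMeasure_spherical (hg0 : ∀ u, 0 ≤ u → 0 ≤ g u) (hC : sphericalMass n g ≠ 0) :
    IsProbabilityMeasure (sphericalMeasure n g) := by
  refine ⟨?_⟩
  have h1 : ∀ z : Unit ⊕ Fin n → ℝ,
      ellipticalDensity 0 1 g z = (sphericalMass n g)⁻¹ * g (z ⬝ᵥ z) := fun z => by
    rw [ellipticalDensity, quadForm_zero_one, det_one, Real.sqrt_one, inv_one, mul_one,
      sphericalMass]
  rw [sphericalMeasure, ellipticalMeasure, withDensity_apply _ MeasurableSet.univ,
    Measure.restrict_univ]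
  simp_rw [h1]
  rw [← ofReal_integral_eq_lintegral_ofReal
    ((integrable_of_sphericalMass_ne_zero hC).const_mul _) (.of_forall fun z => ?_),
    integral_const_mul, ← sphericalMass, inv_mul_cancel₀ hC, ENNReal.ofReal_one]
  have h0 : 0 ≤ z ⬝ᵥ z := by simpa using dotProduct_star_self_nonneg z
  exact mul_nonneg (inv_nonneg.2 (sphericalMass_nonneg hg0)) (hg0 _ h0)

/-- The linear functional `a |z₀| + b'z₁`. -/
def absForm (a : ℝ) (b : Fin n → ℝ) (z : Unit ⊕ Fin n → ℝ) : ℝ :=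
  a * |z (Sum.inl ())| + b ⬝ᵥ fun i => z (Sum.inr i)

@[fun_prop]
theorem continuous_absForm (a : ℝ) (b : Fin n → ℝ) : Continuous (absForm a b) := by
  have : Continuous fun z : Unit ⊕ Fin n → ℝ => b ⬝ᵥ fun i => z (Sum.inr i) :=
    continuous_const.dotProduct (by fun_prop)
  unfold absForm
  fun_prop

/-- The joint characteristic function of `(|z₀|, z₁)` under the spherical law. -/
def absChar (n : ℕ) (g : ℝ → ℝ) (a : ℝ) (b : Fin n → ℝ) : ℂ :=
  ∫ z, Complex.exp (Complex.I * (absForm a b z : ℂ)) ∂(sphericalMeasure n g)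

theorem integral_comp_flip {E : Type*} [NormedAddCommGroup E] [NormedSpace ℝ E]
    (hg : Measurable g) {f : (Unit ⊕ Fin n → ℝ) → E} (hf : Continuous f) :
    ∫ z, f (Sum.elim (fun _ => z (Sum.inl ())) fun i => -z (Sum.inr i)) ∂(sphericalMeasure n g) =
      ∫ z, f z ∂(sphericalMeasure n g) := by
  have hO : (fromBlocks 1 0 0 (-1) : Matrix (Unit ⊕ Fin n) (Unit ⊕ Fin n) ℝ) *
      (fromBlocks 1 0 0 (-1))ᵀ = 1 := by
    rw [fromBlocks_transpose, fromBlocks_multiply]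
    simp
  have hm : Continuous fun u : Unit ⊕ Fin n → ℝ =>
      (fromBlocks 1 0 0 (-1) : Matrix (Unit ⊕ Fin n) (Unit ⊕ Fin n) ℝ) *ᵥ u :=
    continuous_const.matrix_mulVec continuous_id
  conv_rhs => rw [← sphericalMeasure_map_orthogonal hg hO]
  rw [integral_map hm.aemeasurable hf.aestronglyMeasurable]
  refine integral_congr_ae (.of_forall fun z => ?_)
  simp only
  congr 1
  ext i
  rcases i with i | i <;> simp [fromBlocks_mulVec, neg_mulVec]

/-- Flipping `z₁` shows that `b` and `-b` give the same real part. For each `z`, the pair of values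
`±z₀` only permutes the cosines belonging to `b` and `-b`, so in their sum `|z₀|` may be replaced by
`z₀`, which leaves the spherical characteristic function. -/
theorem re_absChar (hg : Measurable g) [IsFiniteMeasure (sphericalMeasure n g)] (a : ℝ)
    (b : Fin n → ℝ) : (absChar n g a b).re = sphericalChar n g (a ^ 2 + b ⬝ᵥ b) := by
  have h1 : ∀ b : Fin n → ℝ, ∫ z, Real.cos (Sum.elim (fun _ => a) b ⬝ᵥ z) ∂(sphericalMeasure n g) =
      sphericalChar n g (a ^ 2 + b ⬝ᵥ b) := by
    intro b
    rw [← re_integral_cexp (continuous_dotProduct_right _).aemeasurable, ← vecChar,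
      vecChar_spherical hg, Complex.ofReal_re, sumElim_dotProduct_self]
  have h2 : (absChar n g a b).re = (absChar n g a (-b)).re := by
    rw [absChar, absChar, ← integral_comp_flip hg (by fun_prop)]
    simp [absForm, dotProduct]
  have h3 : (absChar n g a b).re + (absChar n g a (-b)).re =
      sphericalChar n g (a ^ 2 + b ⬝ᵥ b) + sphericalChar n g (a ^ 2 + (-b) ⬝ᵥ (-b)) := by
    rw [← h1, ← h1, absChar, absChar, re_integral_cexp (by fun_prop), re_integral_cexp (by fun_prop),
      ← integral_add (integrable_cos (by fun_prop)) (integrable_cos (by fun_prop)),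
      ← integral_add (integrable_cos (by fun_prop)) (integrable_cos (by fun_prop))]
    refine integral_congr_ae (.of_forall fun z => ?_)
    have h4 : ∀ b : Fin n → ℝ, (Sum.elim (fun _ => a) b : Unit ⊕ Fin n → ℝ) ⬝ᵥ z =
        a * z (Sum.inl ()) + b ⬝ᵥ fun i => z (Sum.inr i) := by
      intro b; simp [dotProduct]
    simp only [h4, absForm, neg_dotProduct]
    rcases abs_choice (z (Sum.inl ())) with h | h
    · rw [h]
    · rw [h, add_comm, ← Real.cos_neg]
      congr 1
      · congr 1; ring
      · rw [← Real.cos_neg]; congr 1; ring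
  rw [neg_dotProduct_neg, ← h2] at h3
  linarith

end

/-! ### The normal generator and the skew-normal law. -/

section

variable {n : ℕ} {c : ℝ}

/-- The normal generator `u ↦ exp(-u / (2c))`. -/
def normalGenerator (c u : ℝ) : ℝ := Real.exp (-(2 * c)⁻¹ * u)

@[fun_prop]
theorem continuous_normalGenerator (c : ℝ) : Continuous (normalGenerator c) := by
  unfold normalGenerator; fun_prop

theorem normalGenerator_nonneg (c : ℝ) : ∀ u, 0 ≤ u → 0 ≤ normalGenerator c u :=
  fun _ _ => (Real.exp_pos _).le

theorem normalGenerator_add (c u v : ℝ) :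
    normalGenerator c (u + v) = normalGenerator c u * normalGenerator c v := by
  rw [normalGenerator, mul_add, Real.exp_add]; rfl

theorem integral_normalGenerator_mul_cexp (hc : 0 < c) {ι : Type*} [Fintype ι] (w : ι → ℝ) :
    ∫ z : ι → ℝ, (normalGenerator c (z ⬝ᵥ z) : ℂ) * Complex.exp (Complex.I * ((w ⬝ᵥ z : ℝ) : ℂ)) =
      (((2 * Real.pi * c) ^ ((Fintype.card ι : ℝ) / 2) *
        Real.exp (-c * (w ⬝ᵥ w) / 2) : ℝ) : ℂ) := by
  have hb : 0 < (((2 * c)⁻¹ : ℝ) : ℂ).re := by rw [Complex.ofReal_re]; positivity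
  have h := GaussianFourier.integral_cexp_neg_mul_sum_add hb (fun i => Complex.I * (w i : ℂ))
  have h1 : (Real.pi : ℂ) / (((2 * c)⁻¹ : ℝ) : ℂ) = ((2 * Real.pi * c : ℝ) : ℂ) := by
    push_cast
    field_simp
  rw [h1] at h
  rw [Complex.ofReal_mul, Complex.ofReal_cpow (by positivity), Complex.ofReal_exp]
  convert h using 3
  · rename_i z
    rw [normalGenerator, Complex.ofReal_exp, ← Complex.exp_add]
    congr 1
    simp only [dotProduct]
    push_cast
    rw [Finset.mul_sum Finset.univ _ Complex.I]
    congr 1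
    · simp [sq]
    · exact Finset.sum_congr rfl fun i _ => by ring
  · push_cast; rfl
  · simp only [mul_pow, Complex.I_sq, dotProduct]
    push_cast
    rw [← Finset.mul_sum]
    have : (c : ℂ) ≠ 0 := by exact_mod_cast hc.ne'
    field_simp
    norm_num

theorem sphericalMass_normalGenerator (hc : 0 < c) :
    sphericalMass n (normalGenerator c) = (2 * Real.pi * c) ^ (((n : ℝ) + 1) / 2) := by
  have h := integral_normalGenerator_mul_cexp hc (0 : Unit ⊕ Fin n → ℝ)
  simp only [zero_dotProduct, Complex.ofReal_zero, mul_zero, Complex.exp_zero, mul_one,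
    zero_div, Real.exp_zero] at h
  rw [integral_complex_ofReal] at h
  rw [sphericalMass, Complex.ofReal_injective h]
  congr 2
  simp [add_comm]

theorem sphericalMass_normalGenerator_ne_zero (hc : 0 < c) :
    sphericalMass n (normalGenerator c) ≠ 0 := by
  rw [sphericalMass_normalGenerator hc]
  positivity

theorem vecChar_normal (hc : 0 < c) (w : Unit ⊕ Fin n → ℝ) :
    vecChar (sphericalMeasure n (normalGenerator c)) w =
      (Real.exp (-c * (w ⬝ᵥ w) / 2) : ℂ) := by
  have hC := sphericalMass_normalGenerator_ne_zero (n := n) hc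
  rw [vecChar, integral_spherical (continuous_normalGenerator c).measurable
    (normalGenerator_nonneg c)]
  simp_rw [mul_smul, Complex.real_smul]
  rw [integral_const_mul, integral_normalGenerator_mul_cexp hc, ← Complex.ofReal_mul]
  rw [sphericalMass_normalGenerator hc] at hC ⊢
  congr 1
  have : (Fintype.card (Unit ⊕ Fin n) : ℝ) = (n : ℝ) + 1 := by simp [add_comm]
  rw [this, ← mul_assoc, inv_mul_cancel₀ hC, one_mul]

theorem sphericalChar_normal (hc : 0 < c) {s : ℝ} (hs : 0 ≤ s) :
    sphericalChar n (normalGenerator c) s = Real.exp (-c * s / 2) := by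
  rw [sphericalChar, vecChar_normal hc, Complex.ofReal_re, sumElim_dotProduct_self,
    Real.sq_sqrt hs]
  simp

theorem absChar_zero_left {g : ℝ → ℝ} (hg : Measurable g) (b : Fin n → ℝ) :
    absChar n g 0 b = sphericalChar n g (b ⬝ᵥ b) := by
  have h := vecChar_spherical hg (Sum.elim (fun _ => 0) b : Unit ⊕ Fin n → ℝ)
  rw [sumElim_dotProduct_self, zero_pow two_ne_zero, zero_add] at h
  rw [← h, absChar, vecChar]
  refine integral_congr_ae (.of_forall fun z => ?_)
  simp [absForm, dotProduct]

/-- Independence of `z₀` and `z₁`: the transform has the form `K I₁(a) J(b)`, so `h(a, b) h(0, 0) =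
h(a, 0) h(0, b)`, where `h(0, 0) = 1`. The constants `K`, `I₁`, `J` need not be evaluated. -/
theorem absChar_normal (hc : 0 < c) (a : ℝ) (b : Fin n → ℝ) :
    absChar n (normalGenerator c) a b =
      absChar n (normalGenerator c) a 0 * (Real.exp (-c * (b ⬝ᵥ b) / 2) : ℂ) := by
  have hC := sphericalMass_normalGenerator_ne_zero (n := n) hc
  have hm := (continuous_normalGenerator c).measurable
  have key : ∃ (K : ℂ) (I₁ : ℝ → ℂ) (J : (Fin n → ℝ) → ℂ), ∀ a b,
      absChar n (normalGenerator c) a b = K * (I₁ a * J b) := by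
    refine ⟨((sphericalMass n (normalGenerator c))⁻¹ : ℝ),
      fun a => ∫ v : ℝ, (normalGenerator c (v ^ 2) : ℂ) * Complex.exp (Complex.I * ((a * |v| : ℝ) : ℂ)),
      fun b => ∫ u : Fin n → ℝ, (normalGenerator c (u ⬝ᵥ u) : ℂ) *
        Complex.exp (Complex.I * ((b ⬝ᵥ u : ℝ) : ℂ)), fun a b => ?_⟩
    rw [absChar, integral_spherical hm (normalGenerator_nonneg c)]
    simp_rw [mul_smul, Complex.real_smul]
    rw [integral_const_mul, integral_sum_pi, Measure.volume_eq_prod, ← integral_prod_mul]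
    congr 1
    refine integral_congr_ae (.of_forall fun p => ?_)
    simp only [sumElim_dotProduct_self, normalGenerator_add, absForm, Sum.elim_inl, Sum.elim_inr]
    push_cast
    rw [mul_add, Complex.exp_add]
    ring
  have h0 : ∀ b : Fin n → ℝ, absChar n (normalGenerator c) 0 b =
      (Real.exp (-c * (b ⬝ᵥ b) / 2) : ℂ) := fun b => by
    rw [absChar_zero_left hm, sphericalChar_normal hc (by simpa using dotProduct_star_self_nonneg b)]
  have h00 : absChar n (normalGenerator c) 0 0 = 1 := by rw [h0]; simp
  obtain ⟨K, I₁, J, h⟩ := key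
  calc absChar n (normalGenerator c) a b
      = absChar n (normalGenerator c) a b * absChar n (normalGenerator c) 0 0 := by
        rw [h00, mul_one]
    _ = absChar n (normalGenerator c) a 0 * absChar n (normalGenerator c) 0 b := by
        rw [h, h, h, h]; ring
    _ = _ := by rw [h0]

theorem integral_Iic_exp_neg_sq (hc : 0 < c) (p : ℝ) :
    ∫ v in Set.Iic p, Real.exp (-(2 * c)⁻¹ * v ^ 2) =
      √(2 * Real.pi * c) * cdf (gaussianReal 0 1) ((√c)⁻¹ * p) := by
  have hsq : 0 < √c := Real.sqrt_pos.2 hc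
  have hv : NNReal.mk (√c ^ 2) (sq_nonneg _) * 1 = NNReal.mk c hc.le := by
    rw [mul_one]; ext; exact Real.sq_sqrt hc.le
  have h1 := gaussianReal_map_const_mul (μ := 0) (v := 1) (√c)
  rw [mul_zero, hv] at h1
  have h2 : cdf (gaussianReal 0 1) ((√c)⁻¹ * p) = (gaussianReal 0 (NNReal.mk c hc.le)).real (Set.Iic p) := by
    rw [cdf_eq_real, ← h1, map_measureReal_apply (measurable_const_mul _) measurableSet_Iic]
    congr 1
    ext x
    simp only [Set.mem_Iic, Set.mem_preimage]
    rw [inv_mul_eq_div, le_div_iff₀ hsq, mul_comm]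
  have hc0 : NNReal.mk c hc.le ≠ 0 := fun h => hc.ne' (congrArg NNReal.toReal h)
  rw [h2, measureReal_def, gaussianReal_apply_eq_integral _ hc0, ENNReal.toReal_ofReal
    (integral_nonneg fun x => gaussianPDFReal_nonneg _ _ _), ← integral_const_mul]
  refine setIntegral_congr_fun measurableSet_Iic fun x _ => ?_
  have h3 : √(2 * Real.pi * c) ≠ 0 := by positivity
  simp only [gaussianPDFReal, NNReal.coe_mk, sub_zero]
  rw [mul_inv_cancel_left₀ h3]
  congr 1
  ring

/-- The generator contributes the variance `c`, which is absorbed into `Ω`. The parameter `α` stays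
the same because `ω` scales by `√c`, exactly as the standard deviation in the distribution function
does. -/
theorem skewEllipticalMeasure_normalGenerator (hc : 0 < c) (μ : Fin n → ℝ)
    {Ω : Matrix (Fin n) (Fin n) ℝ} (hΩ : Ω.PosDef) (α : Fin n → ℝ) :
    skewEllipticalMeasure μ Ω α (normalGenerator c) = skewNormalMeasure μ (c • Ω) α := by
  rw [skewEllipticalMeasure, skewNormalMeasure]
  congr 1
  funext x
  congr 1
  have hint : Integrable fun v : ℝ => normalGenerator c (quadForm μ Ω x + v ^ 2) := by
    simp_rw [normalGenerator_add]
    exact (integrable_exp_neg_mul_sq (b := (2 * c)⁻¹) (by positivity)).const_mul _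
  have hsc : scaleMatrix (c • Ω) = √c • scaleMatrix Ω := by
    rw [scaleMatrix, scaleMatrix, ← diagonal_smul]
    congr 1
    funext i
    simp [Real.sqrt_mul hc.le]
  have hsq : √c ≠ 0 := (Real.sqrt_pos.2 hc).ne'
  have hinv : (scaleMatrix (c • Ω))⁻¹ = (√c)⁻¹ • (scaleMatrix Ω)⁻¹ := by
    rw [hsc]
    refine Matrix.inv_eq_right_inv ?_
    rw [smul_mul_smul_comm, mul_inv_cancel₀ hsq, one_smul, scaleMatrix_mul_inv hΩ]
  have hOinv : (c • Ω)⁻¹ = c⁻¹ • Ω⁻¹ := by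
    refine Matrix.inv_eq_right_inv ?_
    rw [smul_mul_smul_comm, mul_inv_cancel₀ hc.ne', one_smul,
      mul_nonsing_inv _ hΩ.det_pos.ne'.isUnit]
  have hq : quadForm μ (c • Ω) x = c⁻¹ * quadForm μ Ω x := by
    rw [quadForm, hOinv, smul_mulVec, dotProduct_smul, smul_eq_mul, quadForm]
  rw [skewEllipticalDensity_eq (normalGenerator_nonneg c)
    (sphericalMass_normalGenerator_ne_zero hc) hΩ α hint, skewNormalDensity, hinv, smul_mulVec,
    dotProduct_smul, smul_eq_mul, dotProduct_scaleMatrix_inv hΩ, hq, det_smul, Fintype.card_fin,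
    sphericalMass_normalGenerator hc]
  simp_rw [normalGenerator_add]
  rw [integral_const_mul]
  simp_rw [normalGenerator]
  rw [integral_Iic_exp_neg_sq hc, Real.sqrt_mul (by positivity) Ω.det]
  have h1 : ((2 * Real.pi * c) ^ (((n : ℝ) + 1) / 2))⁻¹ * √(2 * Real.pi * c) =
      (2 * Real.pi) ^ (-(n : ℝ) / 2) * (√(c ^ n))⁻¹ := by
    rw [← Real.rpow_neg (by positivity), Real.sqrt_eq_rpow, ← Real.rpow_add (by positivity),
      Real.sqrt_eq_rpow, ← Real.rpow_natCast, ← Real.rpow_mul hc.le, ← Real.rpow_neg hc.le,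
      Real.mul_rpow (x := 2 * Real.pi) (by positivity) hc.le]
    congr 2 <;> ring
  have h2 : -(2 * c)⁻¹ * quadForm μ Ω x = -(c⁻¹ * quadForm μ Ω x) / 2 := by
    rw [mul_inv]; ring
  rw [h2, mul_inv]
  linear_combination (2 * (√Ω.det)⁻¹ * Real.exp (-(c⁻¹ * quadForm μ Ω x) / 2) *
    cdf (gaussianReal 0 1) ((√c)⁻¹ * (skewEta Ω α ⬝ᵥ (x - μ)))) * h1

end

/-! ### Cauchy's exponential equation on a sector. -/

section

/-- Multiplicativity on a sector excludes zeros and then extends to the whole quadrant, where the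
logarithm is additive and continuous, hence linear. The bound at `1` gives the sign of `c`. -/
theorem exists_exp_of_mul_of_le {χ : ℝ → ℝ} (hχ : Continuous χ) (h0 : χ 0 = 1)
    (hle : χ 1 ≤ 1) {κ : ℝ} (h : ∀ x y, 0 ≤ x → κ * x ≤ y → χ (x + y) = χ x * χ y) :
    ∃ c : ℝ, 0 ≤ c ∧ ∀ s, 0 ≤ s → χ s = Real.exp (-c * s / 2) := by
  set k := max κ 1
  have hk : 0 < k := lt_of_lt_of_le one_pos (le_max_right _ _)
  have h' : ∀ x y, 0 ≤ x → k * x ≤ y → χ (x + y) = χ x * χ y := fun x y hx hy =>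
    h x y hx ((mul_le_mul_of_nonneg_right (le_max_left _ _) hx).trans hy)
  have hne : ∀ s, 0 ≤ s → χ s ≠ 0 := by
    intro s hs hs0
    set Z : Set ℝ := Set.Ici 0 ∩ χ ⁻¹' {0} with hZ
    have hcl : IsClosed Z := isClosed_Ici.inter (isClosed_singleton.preimage hχ)
    have hbd : BddBelow Z := ⟨0, fun x hx => hx.1⟩
    obtain ⟨hz, hz0⟩ : sInf Z ∈ Z := hcl.csInf_mem ⟨s, hs, hs0⟩ hbd
    set z := sInf Z
    have hzpos : 0 < z := lt_of_le_of_ne hz fun he => by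
      have : χ z = 0 := hz0
      rw [← he, h0] at this
      exact one_ne_zero this
    have hmin : ∀ y, 0 ≤ y → y < z → χ y ≠ 0 := fun y hy hyz hy0 =>
      absurd (csInf_le hbd (⟨hy, hy0⟩ : y ∈ Z)) (not_le.2 hyz)
    -- The least zero `z` splits as `x + k x` on the edge of the sector, with both parts positive
    -- and smaller than `z`; one of them would be a smaller zero.
    have hx : 0 < z / (1 + k) := by positivity
    have hsum : z / (1 + k) + k * (z / (1 + k)) = z := by field_simp
    have h1 := h' (z / (1 + k)) (k * (z / (1 + k))) hx.le le_rfl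
    rw [hsum, show χ z = 0 from hz0] at h1
    have hkx : 0 < k * (z / (1 + k)) := by positivity
    rcases mul_eq_zero.1 h1.symm with h2 | h2
    · exact hmin _ hx.le (by linarith) h2
    · exact hmin _ hkx.le (by linarith) h2
  have hmul : ∀ x y, 0 ≤ x → 0 ≤ y → χ (x + y) = χ x * χ y := by
    intro x y hx hy
    -- Adding the large term `k (x + y)` brings every pair involved into the sector; its nonzero
    -- value cancels afterwards.
    have hz : 0 ≤ k * (x + y) := by positivity
    have e1 := h' (x + y) (k * (x + y)) (by positivity) le_rfl
    have e2 := h' x (y + k * (x + y)) hx (by nlinarith)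
    have e3 := h' y (k * (x + y)) hy (by nlinarith)
    rw [← add_assoc, e1, e3] at e2
    exact mul_right_cancel₀ (hne _ hz) (by rw [e2]; ring)
  have hpos : ∀ s, 0 ≤ s → 0 < χ s := fun s hs => by
    rw [← add_halves s, hmul _ _ (by positivity) (by positivity), ← sq]
    exact (sq_nonneg _).lt_of_ne (pow_ne_zero 2 (hne _ (by positivity))).symm
  set L : ℝ → ℝ := fun s => Real.log (χ (max s 0)) with hL
  have hLc : Continuous L := Continuous.log (by fun_prop) fun s => hne _ (le_max_right _ _)
  have hLadd : ∀ x y, 0 ≤ x → 0 ≤ y → L (x + y) = L x + L y := by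
    intro x y hx hy
    simp only [hL]
    rw [max_eq_left hx, max_eq_left hy, max_eq_left (add_nonneg hx hy), hmul x y hx hy,
      Real.log_mul (hne x hx) (hne y hy)]
  have hL0 : L 0 = 0 := by simp [hL, h0]
  -- The odd extension of `L` from the half-line, so that linearity of continuous additive maps
  -- applies.
  let f : ℝ →+ ℝ :=
    { toFun := fun x => L (max x 0) - L (max (-x) 0)
      map_zero' := by simp
      map_add' := fun x y => by
        have e : max (x + y) 0 + (max (-x) 0 + max (-y) 0) =
            max (-(x + y)) 0 + (max x 0 + max y 0) := by
          have hm : ∀ x : ℝ, max x 0 - max (-x) 0 = x := fun x => by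
            rcases le_total x 0 with hx | hx
            · rw [max_eq_right hx, max_eq_left (by linarith)]; ring
            · rw [max_eq_left hx, max_eq_right (by linarith)]; ring
          linarith [hm x, hm y, hm (x + y)]
        have e2 := congrArg L e
        have p : ∀ x : ℝ, 0 ≤ max x 0 := fun x => le_max_right _ _
        rw [hLadd _ _ (p _) (add_nonneg (p _) (p _)), hLadd _ _ (p _) (p _),
          hLadd _ _ (p _) (add_nonneg (p _) (p _)), hLadd _ _ (p _) (p _)] at e2
        linarith }
  have hf : Continuous f := by
    change Continuous fun x => L (max x 0) - L (max (-x) 0)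
    fun_prop
  have hflin : ∀ x, f x = x * f 1 := fun x => by
    have := (f.toRealLinearMap hf).map_smul x 1
    simpa using this
  have hfL : ∀ x, 0 ≤ x → f x = Real.log (χ x) := fun x hx => by
    change L (max x 0) - L (max (-x) 0) = _
    rw [max_eq_left hx, max_eq_right (by linarith), hL0, sub_zero]
    simp only [hL, max_eq_left hx]
  refine ⟨-2 * Real.log (χ 1), ?_, fun s hs => ?_⟩
  · linarith [Real.log_nonpos (hpos 1 zero_le_one).le hle]
  · have h1 := hflin s
    rw [hfL s hs, hfL 1 zero_le_one] at h1
    rw [← Real.exp_log (hpos s hs), h1]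
    congr 1
    ring

variable {n : ℕ} {g : ℝ → ℝ}

theorem continuous_sphericalChar [IsFiniteMeasure (sphericalMeasure n g)] :
    Continuous (sphericalChar n g) := by
  refine Complex.continuous_re.comp ?_
  refine continuous_of_dominated (bound := fun _ => 1) (fun s => ?_) (fun s => .of_forall fun z => ?_)
    (integrable_const 1) (.of_forall fun z => ?_)
  · exact (integrable_cexp (continuous_dotProduct_right _).aemeasurable).aestronglyMeasurable
  · rw [mul_comm, Complex.norm_exp_ofReal_mul_I]
  · have : Continuous fun s : ℝ => (Sum.elim (fun _ => √s) 0 : Unit ⊕ Fin n → ℝ) ⬝ᵥ z := by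
      simp only [dotProduct, Fintype.sum_sum_type, Sum.elim_inl, Sum.elim_inr]
      fun_prop
    fun_prop

theorem sphericalChar_zero [IsProbabilityMeasure (sphericalMeasure n g)] :
    sphericalChar n g 0 = 1 := by
  have : (Sum.elim (fun _ => √0) 0 : Unit ⊕ Fin n → ℝ) = 0 := by
    ext i; rcases i with i | i <;> simp
  rw [sphericalChar, this, vecChar]
  simp

theorem sphericalChar_le_one [IsProbabilityMeasure (sphericalMeasure n g)] (s : ℝ) :
    sphericalChar n g s ≤ 1 := by
  rw [sphericalChar, vecChar, re_integral_cexp (continuous_dotProduct_right _).aemeasurable]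
  calc _ ≤ ∫ _z : Unit ⊕ Fin n → ℝ, (1 : ℝ) ∂(sphericalMeasure n g) :=
        integral_mono (integrable_cos (continuous_dotProduct_right _).aemeasurable)
          (integrable_const 1) fun z => Real.cos_le_one _
    _ = 1 := by simp

theorem sphericalMeasure_eq_of_char {g' : ℝ → ℝ} (hg : Measurable g) (hg' : Measurable g')
    [IsFiniteMeasure (sphericalMeasure n g)] [IsFiniteMeasure (sphericalMeasure n g')]
    (h : ∀ s, 0 ≤ s → sphericalChar n g s = sphericalChar n g' s) :
    sphericalMeasure n g = sphericalMeasure n g' :=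
  measure_ext_of_vecChar fun w => by
    rw [vecChar_spherical hg, vecChar_spherical hg', h _ (by simpa using dotProduct_star_self_nonneg w)]

theorem ae_spherical_ne_zero (n : ℕ) (g : ℝ → ℝ) :
    ∀ᵐ z ∂(sphericalMeasure n g), z (Sum.inl ()) ≠ 0 := by
  have hac : sphericalMeasure n g ≪ volume := withDensity_absolutelyContinuous _ _
  suffices h : ∀ᵐ z : Unit ⊕ Fin n → ℝ, z (Sum.inl ()) ≠ 0 from hac.ae_le h
  rw [ae_iff]
  simp only [not_not]
  exact Measure.pi_hyperplane _ (Sum.inl ()) 0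

/-- The functional equation gives `exp(-c s / 2)`. For `c = 0` the law would be a point mass at `0`,
whereas a law with a density does not charge the hyperplane `z₀ = 0`. -/
theorem exists_sphericalMeasure_eq_normal (hg : Measurable g)
    [IsProbabilityMeasure (sphericalMeasure n g)] {κ : ℝ}
    (h : ∀ x y, 0 ≤ x → κ * x ≤ y → sphericalChar n g (x + y) =
      sphericalChar n g x * sphericalChar n g y) :
    ∃ c : ℝ, 0 < c ∧ sphericalMeasure n g = sphericalMeasure n (normalGenerator c) := by
  obtain ⟨c, hc, hχ⟩ := exists_exp_of_mul_of_le continuous_sphericalChar sphericalChar_zero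
    (sphericalChar_le_one 1) h
  rcases hc.eq_or_lt with rfl | hc
  · exfalso
    have hd : sphericalMeasure n g = Measure.dirac 0 := by
      refine measure_ext_of_vecChar fun w => ?_
      rw [vecChar_spherical hg, hχ _ (by simpa using dotProduct_star_self_nonneg w), vecChar,
        integral_dirac]
      simp
    have := ae_spherical_ne_zero n g
    rw [hd, ae_dirac_iff (by measurability)] at this
    exact this rfl
  · have := isProbabilityMeasure_spherical (n := n) (normalGenerator_nonneg c)
      (sphericalMass_normalGenerator_ne_zero hc)
    refine ⟨c, hc, sphericalMeasure_eq_of_char hg (continuous_normalGenerator c).measurable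
      fun s hs => ?_⟩
    rw [hχ s hs, sphericalChar_normal hc hs]

end

/-! ### Translating (P) to `absChar`, reachable arguments, and asymmetry. -/

section

variable {n : ℕ} {g : ℝ → ℝ} {Ω : Matrix (Fin n) (Fin n) ℝ}

theorem dotProduct_transpose_mulVec_self {B M : Matrix (Fin n) (Fin n) ℝ} (hB : B * Bᵀ = M)
    (t : Fin n → ℝ) : (Bᵀ *ᵥ t) ⬝ᵥ (Bᵀ *ᵥ t) = t ⬝ᵥ (M *ᵥ t) := by
  rw [← hB, ← mulVec_mulVec, dotProduct_mulVec t B, mulVec_transpose]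

theorem dotProduct_skewCov (Ω : Matrix (Fin n) (Fin n) ℝ) (α t : Fin n → ℝ) :
    t ⬝ᵥ (skewCov Ω α *ᵥ t) = t ⬝ᵥ (Ω *ᵥ t) - (t ⬝ᵥ skewDeltaW Ω α) ^ 2 := by
  rw [skewCov, sub_mulVec, vecMulVec_mulVec, dotProduct_sub, op_smul_eq_smul, dotProduct_smul,
    smul_eq_mul, dotProduct_comm (skewDeltaW Ω α), sq]

/-- The map `z ↦ μ + δ_w |z₀| + B z₁`. -/
def skewMap (μ : Fin n → ℝ) (Ω : Matrix (Fin n) (Fin n) ℝ) (α : Fin n → ℝ)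
    (B : Matrix (Fin n) (Fin n) ℝ) (z : Unit ⊕ Fin n → ℝ) : Fin n → ℝ :=
  μ + |z (Sum.inl ())| • skewDeltaW Ω α + B *ᵥ fun i => z (Sum.inr i)

theorem continuous_skewMap (μ : Fin n → ℝ) (Ω : Matrix (Fin n) (Fin n) ℝ) (α : Fin n → ℝ)
    (B : Matrix (Fin n) (Fin n) ℝ) : Continuous (skewMap μ Ω α B) := by
  have : Continuous fun z : Unit ⊕ Fin n → ℝ => B *ᵥ fun i => z (Sum.inr i) :=
    continuous_const.matrix_mulVec (by fun_prop)
  unfold skewMap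
  fun_prop

theorem dotProduct_skewMap (μ : Fin n → ℝ) (α : Fin n → ℝ) (B : Matrix (Fin n) (Fin n) ℝ)
    (t : Fin n → ℝ) (z : Unit ⊕ Fin n → ℝ) :
    t ⬝ᵥ skewMap μ Ω α B z = t ⬝ᵥ μ + absForm (t ⬝ᵥ skewDeltaW Ω α) (Bᵀ *ᵥ t) z := by
  rw [skewMap, dotProduct_add, dotProduct_add, dotProduct_smul, smul_eq_mul, dotProduct_mulVec,
    absForm, mulVec_transpose, mul_comm, add_assoc]

theorem vecChar_skewElliptical (hg : Measurable g) (hg0 : ∀ u, 0 ≤ u → 0 ≤ g u)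
    (hC : sphericalMass n g ≠ 0) (μ : Fin n → ℝ) (hΩ : Ω.PosDef)
    (α : Fin n → ℝ) {B : Matrix (Fin n) (Fin n) ℝ} (hB : B * Bᵀ = skewCov Ω α) (t : Fin n → ℝ) :
    vecChar (skewEllipticalMeasure μ Ω α g) t = Complex.exp (Complex.I * ((t ⬝ᵥ μ : ℝ) : ℂ)) *
      absChar n g (t ⬝ᵥ skewDeltaW Ω α) (Bᵀ *ᵥ t) := by
  rw [← map_skewMap_spherical hg hg0 hC μ hΩ α hB, vecChar, absChar, ← integral_const_mul]
  change ∫ x, _ ∂(Measure.map (skewMap μ Ω α B) _) = _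
  rw [integral_map (continuous_skewMap μ Ω α B).aemeasurable
    (Continuous.aestronglyMeasurable (by fun_prop))]
  refine integral_congr_ae (.of_forall fun z => ?_)
  simp only
  rw [dotProduct_skewMap, ← Complex.exp_add, Complex.ofReal_add, mul_add]

theorem exists_dotProduct_mulVec_eq (hn : 1 ≤ n) (hΩ : Ω.PosDef) {s : ℝ} (hs : 0 ≤ s) :
    ∃ t : Fin n → ℝ, t ⬝ᵥ (Ω *ᵥ t) = s := by
  have hd : 0 < Ω ⟨0, hn⟩ ⟨0, hn⟩ := hΩ.diag_pos
  refine ⟨Pi.single ⟨0, hn⟩ √(s / Ω ⟨0, hn⟩ ⟨0, hn⟩), ?_⟩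
  rw [single_dotProduct, mulVec_single, op_smul_eq_smul]
  simp only [Pi.smul_apply, smul_eq_mul, col_apply]
  rw [← mul_assoc, Real.mul_self_sqrt (by positivity), div_mul_cancel₀ _ hd.ne']

/-- If the skew-elliptical laws of two generators agree then so do the spherical laws. -/
theorem sphericalMeasure_eq_of_skewElliptical_eq (hn : 1 ≤ n) {g' : ℝ → ℝ} (hg : Measurable g)
    (hg0 : ∀ u, 0 ≤ u → 0 ≤ g u) (hC : sphericalMass n g ≠ 0) (hg' : Measurable g')
    (hg0' : ∀ u, 0 ≤ u → 0 ≤ g' u) (hC' : sphericalMass n g' ≠ 0) (μ : Fin n → ℝ)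
    (hΩ : Ω.PosDef) (α : Fin n → ℝ)
    (h : skewEllipticalMeasure μ Ω α g = skewEllipticalMeasure μ Ω α g') :
    sphericalMeasure n g = sphericalMeasure n g' := by
  have := isProbabilityMeasure_spherical hg0 hC
  have := isProbabilityMeasure_spherical hg0' hC'
  obtain ⟨B, -, hB⟩ := exists_mul_transpose_eq (skewCov_posDef hΩ α)
  refine sphericalMeasure_eq_of_char hg hg' fun s hs => ?_
  obtain ⟨t, rfl⟩ := exists_dotProduct_mulVec_eq hn hΩ hs
  have h1 := vecChar_skewElliptical hg hg0 hC μ hΩ α hB t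
  rw [h, vecChar_skewElliptical hg' hg0' hC' μ hΩ α hB t] at h1
  -- In the real part the two arguments add up to `(t'δ_w)² + t'Ωt - (t'δ_w)² = t'Ωt`, which takes
  -- every value `s ≥ 0`.
  have h2 := congrArg Complex.re (mul_left_cancel₀ (Complex.exp_ne_zero _) h1)
  rw [re_absChar hg, re_absChar hg', dotProduct_transpose_mulVec_self hB, dotProduct_skewCov,
    add_sub_cancel] at h2
  exact h2.symm

theorem absChar_congr {g' : ℝ → ℝ} (h : sphericalMeasure n g = sphericalMeasure n g')
    (a : ℝ) (b : Fin n → ℝ) : absChar n g a b = absChar n g' a b := by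
  rw [absChar, absChar, h]

theorem skewEllipticalMeasure_congr {g' : ℝ → ℝ} (hg : Measurable g)
    (hg0 : ∀ u, 0 ≤ u → 0 ≤ g u) (hC : sphericalMass n g ≠ 0) (hg' : Measurable g')
    (hg0' : ∀ u, 0 ≤ u → 0 ≤ g' u) (hC' : sphericalMass n g' ≠ 0) (μ : Fin n → ℝ)
    (hΩ : Ω.PosDef) (α : Fin n → ℝ) (h : sphericalMeasure n g = sphericalMeasure n g') :
    skewEllipticalMeasure μ Ω α g = skewEllipticalMeasure μ Ω α g' := by
  obtain ⟨B, -, hB⟩ := exists_mul_transpose_eq (skewCov_posDef hΩ α)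
  rw [← map_skewMap_spherical hg hg0 hC μ hΩ α hB, ← map_skewMap_spherical hg' hg0' hC' μ hΩ α hB]
  exact congrArg _ h

theorem skewEta_ne_zero (hΩ : Ω.PosDef) {α : Fin n → ℝ} (hα : α ≠ 0) : skewEta Ω α ≠ 0 := by
  intro h
  apply hα
  rw [← one_mulVec α, ← scaleMatrix_mul_inv hΩ, ← mulVec_mulVec, ← skewEta, h, mulVec_zero]

theorem eta_dotProduct_deltaW_pos (hΩ : Ω.PosDef) {α : Fin n → ℝ} (hα : α ≠ 0) :
    0 < skewEta Ω α ⬝ᵥ skewDeltaW Ω α := by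
  rw [eta_dotProduct_deltaW hΩ, skewNorm_sq hΩ, add_sub_cancel_left]
  refine div_pos ?_ (skewNorm_pos hΩ α)
  simpa using hΩ.dotProduct_mulVec_pos (skewEta_ne_zero hΩ hα)

theorem exists_ne_zero_dotProduct_eq_zero (hn : 2 ≤ n) (d : Fin n → ℝ) :
    ∃ t : Fin n → ℝ, t ≠ 0 ∧ t ⬝ᵥ d = 0 := by
  set i : Fin n := ⟨0, by omega⟩
  set j : Fin n := ⟨1, by omega⟩
  have hij : j ≠ i := by simp [i, j, Fin.ext_iff]
  by_cases hd : d i = 0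
  · exact ⟨Pi.single i 1, by simp, by simp [hd]⟩
  · refine ⟨Pi.single i (d j) - Pi.single j (d i), fun h => ?_, ?_⟩
    · have := congrFun h j
      simp [hij, hd] at this
    · rw [sub_dotProduct, single_dotProduct, single_dotProduct]
      ring

/-- Take `t₀` proportional to `η` with `t₀'δ_w = 1`, possible since `α ≠ 0`, and `t₁ ≠ 0` orthogonal
to `δ_w`, possible since `n ≥ 2`. They are orthogonal for `Ω - δ_w δ_w'`, which sends `η` to a
multiple of `δ_w`. Then `√x t₀` fixes the first value at `x` and a multiple of `t₁` raises the
second freely above `κ x`, where `κ` is the quadratic form at `t₀`. -/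
theorem exists_vector_of_le (hn : 2 ≤ n) (hΩ : Ω.PosDef) {α : Fin n → ℝ} (hα : α ≠ 0) :
    ∃ κ : ℝ, ∀ x y, 0 ≤ x → κ * x ≤ y → ∃ t : Fin n → ℝ,
      (t ⬝ᵥ skewDeltaW Ω α) ^ 2 = x ∧ t ⬝ᵥ (skewCov Ω α *ᵥ t) = y := by
  obtain ⟨t₁, ht₁, hd₁⟩ := exists_ne_zero_dotProduct_eq_zero hn (skewDeltaW Ω α)
  have hM := skewCov_posDef hΩ α
  have hm : 0 < t₁ ⬝ᵥ (skewCov Ω α *ᵥ t₁) := by simpa using hM.dotProduct_mulVec_pos ht₁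
  set m := t₁ ⬝ᵥ (skewCov Ω α *ᵥ t₁) with hmdef
  have hk := eta_dotProduct_deltaW_pos hΩ hα
  set k := skewEta Ω α ⬝ᵥ skewDeltaW Ω α with hkdef
  obtain ⟨t₀, ht₀⟩ : ∃ t₀, t₀ = k⁻¹ • skewEta Ω α := ⟨_, rfl⟩
  have hd₀ : t₀ ⬝ᵥ skewDeltaW Ω α = 1 := by
    rw [ht₀, smul_dotProduct, smul_eq_mul, ← hkdef, inv_mul_cancel₀ hk.ne']
  have h10 : t₁ ⬝ᵥ (skewCov Ω α *ᵥ t₀) = 0 := by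
    rw [ht₀, mulVec_smul, skewCov_mulVec_eta hΩ, dotProduct_smul, dotProduct_smul, hd₁]
    simp
  have h01 : t₀ ⬝ᵥ (skewCov Ω α *ᵥ t₁) = 0 := by
    rw [dotProduct_mulVec, ← mulVec_transpose, transpose_eq hM, dotProduct_comm, h10]
  refine ⟨t₀ ⬝ᵥ (skewCov Ω α *ᵥ t₀), fun x y hx hy => ?_⟩
  have hr : 0 ≤ (y - t₀ ⬝ᵥ (skewCov Ω α *ᵥ t₀) * x) / m := div_nonneg (by linarith) hm.le
  refine ⟨√x • t₀ + √((y - t₀ ⬝ᵥ (skewCov Ω α *ᵥ t₀) * x) / m) • t₁, ?_, ?_⟩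
  · rw [add_dotProduct, smul_dotProduct, smul_dotProduct, hd₀, hd₁]
    simp [Real.sq_sqrt hx]
  · simp only [mulVec_add, mulVec_smul, add_dotProduct, dotProduct_add, smul_dotProduct,
      dotProduct_smul, smul_eq_mul, h10, h01, ← hmdef, mul_zero, add_zero, zero_add]
    rw [← mul_assoc, ← mul_assoc, Real.mul_self_sqrt hx, Real.mul_self_sqrt hr,
      div_mul_cancel₀ _ hm.ne']
    ring

/-- A real characteristic function means a symmetric law, so every bounded odd function of `t'X` has
mean zero. For `t = η` and `w = b'z₁` the means of `arctan(a |z₀| + w)` and `arctan(a |z₀| - w)`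
agree by the flip, yet their sum is strictly positive almost surely since `a > 0`. Using `arctan`
avoids moment assumptions. -/
theorem not_forall_im_vecChar_eq_zero (hg : Measurable g) (hg0 : ∀ u, 0 ≤ u → 0 ≤ g u)
    (hC : sphericalMass n g ≠ 0) (hΩ : Ω.PosDef) {α : Fin n → ℝ} (hα : α ≠ 0) :
    ¬ ∀ t, (vecChar (skewEllipticalMeasure 0 Ω α g) t).im = 0 := by
  intro h
  have := isProbabilityMeasure_spherical hg0 hC
  obtain ⟨B, -, hB⟩ := exists_mul_transpose_eq (skewCov_posDef hΩ α)
  have hT := (continuous_skewMap 0 Ω α B).measurable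
  have hmap : (sphericalMeasure n g).map (skewMap 0 Ω α B) = skewEllipticalMeasure 0 Ω α g :=
    map_skewMap_spherical hg hg0 hC 0 hΩ α hB
  have hfin : IsFiniteMeasure (skewEllipticalMeasure 0 Ω α g) := by
    rw [← hmap]; infer_instance
  set m := skewEllipticalMeasure 0 Ω α g
  have hsym : m.map (fun x => -x) = m := by
    refine measure_ext_of_vecChar fun w => ?_
    have h1 : vecChar (m.map fun x => -x) w = vecChar m (-w) := by
      rw [vecChar, vecChar, integral_map (by fun_prop) (Continuous.aestronglyMeasurable (by fun_prop))]
      simp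
    rw [h1, vecChar_neg]
    exact Complex.conj_eq_iff_im.2 (h w)
  set t := skewEta Ω α
  have ha : 0 < t ⬝ᵥ skewDeltaW Ω α := eta_dotProduct_deltaW_pos hΩ hα
  set a := t ⬝ᵥ skewDeltaW Ω α
  set b := Bᵀ *ᵥ t
  have h0 : ∫ x, Real.arctan (t ⬝ᵥ x) ∂m = 0 := by
    have h1 : ∫ x, Real.arctan (t ⬝ᵥ x) ∂m = -∫ x, Real.arctan (t ⬝ᵥ x) ∂m := by
      conv_lhs => rw [← hsym]
      rw [integral_map (by fun_prop) (Continuous.aestronglyMeasurable (by fun_prop)),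
        ← integral_neg]
      simp [Real.arctan_neg]
    linarith
  have h1 : ∫ z, Real.arctan (absForm a b z) ∂(sphericalMeasure n g) = 0 := by
    rw [← h0, ← hmap, integral_map hT.aemeasurable (Continuous.aestronglyMeasurable (by fun_prop))]
    simp only [dotProduct_skewMap, dotProduct_zero, zero_add]
    rfl
  have h2 : ∫ z, Real.arctan (absForm a (-b) z) ∂(sphericalMeasure n g) = 0 := by
    rw [← h1, ← integral_comp_flip hg (by fun_prop)]
    simp [absForm, dotProduct]
  have hint : ∀ b : Fin n → ℝ, Integrable (fun z => Real.arctan (absForm a b z))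
      (sphericalMeasure n g) := fun b =>
    Integrable.of_bound (C := Real.pi / 2) (Continuous.aestronglyMeasurable (by fun_prop))
      (.of_forall fun z => by
        rw [Real.norm_eq_abs, abs_le]
        exact ⟨(Real.neg_pi_div_two_lt_arctan _).le, (Real.arctan_lt_pi_div_two _).le⟩)
  have h3 : ∀ z : Unit ⊕ Fin n → ℝ, Real.arctan (absForm a b z) + Real.arctan (absForm a (-b) z) =
      Real.arctan (absForm a b z) - Real.arctan (absForm a b z - 2 * (a * |z (Sum.inl ())|)) := by
    intro z
    rw [sub_eq_add_neg, ← Real.arctan_neg]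
    congr 2
    simp only [absForm, neg_dotProduct]
    ring
  have h4 : ∫ z, (Real.arctan (absForm a b z) + Real.arctan (absForm a (-b) z))
      ∂(sphericalMeasure n g) = 0 := by
    rw [integral_add (hint _) (hint _), h1, h2, add_zero]
  have h5 : ∀ z, 0 ≤ Real.arctan (absForm a b z) + Real.arctan (absForm a (-b) z) := fun z => by
    rw [h3, sub_nonneg]
    refine Real.arctan_strictMono.monotone ?_
    have : 0 ≤ a * |z (Sum.inl ())| := by positivity
    linarith
  have h6 := (integral_eq_zero_iff_of_nonneg h5 (by exact (hint _).add (hint _))).1 h4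
  have h7 : ∀ᵐ _ ∂(sphericalMeasure n g), False := by
    filter_upwards [h6, ae_spherical_ne_zero n g] with z hz hz0
    simp only [Pi.zero_apply] at hz
    rw [h3, sub_eq_zero] at hz
    have := Real.arctan_injective hz
    have : 0 < a * |z (Sum.inl ())| := mul_pos ha (abs_pos.2 hz0)
    linarith
  exact h7.exists.choose_spec

theorem sphericalMass_ne_zero_of_isProbabilityMeasure {S : Matrix (Unit ⊕ Fin n) (Unit ⊕ Fin n) ℝ}
    (h : IsProbabilityMeasure (ellipticalMeasure 0 S g)) : sphericalMass n g ≠ 0 := by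
  intro hC
  have h0 : ellipticalMeasure 0 S g = 0 := by
    have : ∀ z, ellipticalDensity 0 S g z = 0 := fun z => by
      rw [ellipticalDensity, ← sphericalMass, hC]; simp
    simp [ellipticalMeasure, this]
  exact IsProbabilityMeasure.ne_zero _ h0

/-- The law of `(U₀, U)` is the image of the spherical one under `diag(1, R)` with `R Rᵀ = Ψ`, which
leaves the first coordinate untouched. -/
theorem integral_abs_eq_absChar (hg : Measurable g) (hΩ : Ω.PosDef) (α : Fin n → ℝ)
    {S' : Type*} [MeasurableSpace S'] {Q : Measure S'} {U₀ : S' → ℝ} {U : S' → Fin n → ℝ}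
    (hU : HasLaw (fun s => (Sum.elim (fun _ => U₀ s) (U s) : Unit ⊕ Fin n → ℝ))
      (ellipticalMeasure 0 (Matrix.fromBlocks 1 0 0 (skewPsi Ω α)) g) Q) (a : ℝ) :
    ∫ s, Complex.exp (Complex.I * ((a * |U₀ s| : ℝ) : ℂ)) ∂Q = absChar n g a 0 := by
  obtain ⟨R, hR0, hR⟩ := exists_mul_transpose_eq (skewPsi_posDef hΩ α)
  have hA : (fromBlocks 1 0 0 R : Matrix (Unit ⊕ Fin n) (Unit ⊕ Fin n) ℝ).det ≠ 0 := by
    rw [det_fromBlocks_zero₂₁, det_one, one_mul]; exact hR0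
  have hm := map_mulVec_ellipticalMeasure hg hA
  have hA2 : (fromBlocks 1 0 0 R : Matrix (Unit ⊕ Fin n) (Unit ⊕ Fin n) ℝ) *
      (fromBlocks 1 0 0 R)ᵀ = fromBlocks 1 0 0 (skewPsi Ω α) := by
    rw [fromBlocks_transpose, fromBlocks_multiply, ← hR]
    simp
  rw [hA2] at hm
  have hcm : Continuous fun u : Unit ⊕ Fin n → ℝ =>
      (fromBlocks 1 0 0 R : Matrix (Unit ⊕ Fin n) (Unit ⊕ Fin n) ℝ) *ᵥ u :=
    continuous_const.matrix_mulVec continuous_id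
  have h := integral_map hU.aemeasurable
    (f := fun z : Unit ⊕ Fin n → ℝ => Complex.exp (Complex.I * ((a * |z (Sum.inl ())| : ℝ) : ℂ)))
    (Continuous.aestronglyMeasurable (by fun_prop))
  simp only [Sum.elim_inl] at h
  rw [← h, hU.map_eq, ← hm, integral_map hcm.aemeasurable
    (Continuous.aestronglyMeasurable (by fun_prop)), absChar]
  refine integral_congr_ae (.of_forall fun z => ?_)
  simp [absForm, fromBlocks_mulVec]

theorem hasProductForm_iff (hg : Measurable g) (hg0 : ∀ u, 0 ≤ u → 0 ≤ g u)
    (hC : sphericalMass n g ≠ 0) (μ : Fin n → ℝ) (hΩ : Ω.PosDef) (α : Fin n → ℝ)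
    {S' : Type*} [MeasurableSpace S'] {Q : Measure S'} {U₀ : S' → ℝ} {U : S' → Fin n → ℝ}
    (hU : HasLaw (fun s => (Sum.elim (fun _ => U₀ s) (U s) : Unit ⊕ Fin n → ℝ))
      (ellipticalMeasure 0 (Matrix.fromBlocks 1 0 0 (skewPsi Ω α)) g) Q)
    {B : Matrix (Fin n) (Fin n) ℝ} (hB : B * Bᵀ = skewCov Ω α) :
    HasProductForm Q U₀ μ Ω α (vecChar (skewEllipticalMeasure μ Ω α g)) ↔
      ∃ φ : ℝ → ℝ, ∀ t : Fin n → ℝ, absChar n g (t ⬝ᵥ skewDeltaW Ω α) (Bᵀ *ᵥ t) =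
        absChar n g (t ⬝ᵥ skewDeltaW Ω α) 0 * (φ ((Bᵀ *ᵥ t) ⬝ᵥ (Bᵀ *ᵥ t)) : ℂ) := by
  refine exists_congr fun φ => forall_congr' fun t => ?_
  rw [vecChar_skewElliptical hg hg0 hC μ hΩ α hB, integral_abs_eq_absChar hg hΩ α hU,
    ← dotProduct_skewCov, dotProduct_transpose_mulVec_self hB, mul_assoc,
    mul_right_inj' (Complex.exp_ne_zero _)]

end

end SkewElliptical

end

/-! ### The main theorem. -/

theorem mainTheorem5 {n : ℕ} (hn : 1 ≤ n)
    (μ : Fin n → ℝ) (Ω : Matrix (Fin n) (Fin n) ℝ) (hΩ : Ω.PosDef) (α : Fin n → ℝ)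
    (g : ℝ → ℝ) (hg : SkewElliptical.IsDensityGenerator (n + 1) g)
    {S : Type*} [MeasurableSpace S] (P : Measure S) [IsProbabilityMeasure P]
    (X : S → Fin n → ℝ)
    (hX : HasLaw X (SkewElliptical.skewEllipticalMeasure μ Ω α g) P)
    {S' : Type*} [MeasurableSpace S'] (Q : Measure S') [IsProbabilityMeasure Q]
    (U₀ : S' → ℝ) (U : S' → Fin n → ℝ)
    (hU : HasLaw (fun s => (Sum.elim (fun _ => U₀ s) (U s) : Unit ⊕ Fin n → ℝ))
      (SkewElliptical.ellipticalMeasure 0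
        (Matrix.fromBlocks 1 0 0 (SkewElliptical.skewPsi Ω α)) g) Q) :
    (2 ≤ n → α ≠ 0 →
      (SkewElliptical.HasProductForm Q U₀ μ Ω α (SkewElliptical.characteristicFunction P X) ↔
        ∃ c : ℝ, 0 < c ∧ HasLaw X (SkewElliptical.skewNormalMeasure μ (c • Ω) α) P)) ∧
    ((∃ c : ℝ, 0 < c ∧ HasLaw X (SkewElliptical.skewNormalMeasure μ (c • Ω) α) P) →
      SkewElliptical.HasProductForm Q U₀ μ Ω α (SkewElliptical.characteristicFunction P X)) ∧
    (μ = 0 → Ω = 1 → α ≠ 0 →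
      ¬ SkewElliptical.HasGentonLoperfidoForm (SkewElliptical.characteristicFunction P X)) := by
  open SkewElliptical in
  have hgm := hg.measurable
  have hg0 := hg.nonneg
  -- A zero normalizing integral would make the law of `(U₀, U)` the zero measure.
  have hC : sphericalMass n g ≠ 0 := by
    have hQ := Measure.isProbabilityMeasure_map (μ := Q) hU.aemeasurable
    rw [hU.map_eq] at hQ
    exact sphericalMass_ne_zero_of_isProbabilityMeasure hQ
  have hprob := isProbabilityMeasure_spherical hg0 hC
  have hchar : characteristicFunction P X = vecChar (skewEllipticalMeasure μ Ω α g) := by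
    funext t
    rw [← hX.map_eq, vecChar, integral_map hX.aemeasurable
      (Continuous.aestronglyMeasurable (by fun_prop)), characteristicFunction]
  obtain ⟨B, -, hB⟩ := exists_mul_transpose_eq (skewCov_posDef hΩ α)
  have hback : (∃ c : ℝ, 0 < c ∧ HasLaw X (skewNormalMeasure μ (c • Ω) α) P) →
      HasProductForm Q U₀ μ Ω α (characteristicFunction P X) := by
    rintro ⟨c, hc, hXc⟩
    rw [hchar, hasProductForm_iff hgm hg0 hC μ hΩ α hU hB]
    -- The generator of `X` need not be the normal one pointwise; only the spherical laws are
    -- compared.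
    have hν : sphericalMeasure n g = sphericalMeasure n (normalGenerator c) :=
      sphericalMeasure_eq_of_skewElliptical_eq hn hgm hg0 hC
        (continuous_normalGenerator c).measurable (normalGenerator_nonneg c)
        (sphericalMass_normalGenerator_ne_zero hc) μ hΩ α (by
          rw [skewEllipticalMeasure_normalGenerator hc μ hΩ, ← hXc.map_eq, hX.map_eq])
    refine ⟨fun v => Real.exp (-c * v / 2), fun t => ?_⟩
    rw [absChar_congr hν, absChar_congr hν, absChar_normal hc]
  refine ⟨fun hn2 hα => ⟨fun h => ?_, hback⟩, hback, fun hμ _ hα => ?_⟩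
  · rw [hchar, hasProductForm_iff hgm hg0 hC μ hΩ α hU hB] at h
    obtain ⟨φ, hφ⟩ := h
    obtain ⟨κ, hκ⟩ := exists_vector_of_le hn2 hΩ hα
    have hre : ∀ x y, 0 ≤ x → κ * x ≤ y →
        sphericalChar n g (x + y) = sphericalChar n g x * φ y := by
      intro x y hx hy
      obtain ⟨t, rfl, rfl⟩ := hκ x y hx hy
      have h1 := congrArg Complex.re (hφ t)
      rw [Complex.re_mul_ofReal, re_absChar hgm, re_absChar hgm, dotProduct_zero, add_zero,
        dotProduct_transpose_mulVec_self hB] at h1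
      exact h1
    have hφχ : ∀ y, 0 ≤ y → φ y = sphericalChar n g y := fun y hy => by
      have := hre 0 y le_rfl (by simpa using hy)
      rw [zero_add, sphericalChar_zero, one_mul] at this
      exact this.symm
    -- Replacing `κ` by `max κ 0` guarantees `y ≥ 0` on the sector, where `φ` coincides with the
    -- characteristic generator.
    obtain ⟨c, hc, hν⟩ := exists_sphericalMeasure_eq_normal (n := n) hgm (κ := max κ 0)
      fun x y hx hy => by
        have h1 : κ * x ≤ y := (mul_le_mul_of_nonneg_right (le_max_left _ _) hx).trans hy
        have h2 : 0 ≤ y := (mul_nonneg (le_max_right _ _) hx).trans hy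
        rw [hre x y hx h1, hφχ y h2]
    refine ⟨c, hc, hX.aemeasurable, ?_⟩
    rw [hX.map_eq, ← skewEllipticalMeasure_normalGenerator hc μ hΩ]
    exact skewEllipticalMeasure_congr hgm hg0 hC (continuous_normalGenerator c).measurable
      (normalGenerator_nonneg c) (sphericalMass_normalGenerator_ne_zero hc) μ hΩ α hν
  -- The proposed form is real-valued, so all imaginary parts would vanish.
  · rintro ⟨φ, k, -, -, hk⟩
    subst hμ
    refine not_forall_im_vecChar_eq_zero hgm hg0 hC hΩ hα fun t => ?_
    rw [← hchar, hk, Complex.ofReal_im]
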